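/- Let $k$ be a field and let $C$ be a smooth projective geometrically connected curve over $k$. A chain of length $r$ on $C$ is a collection $\mathcal E_\bullet=((\mathcal E_i)_{0\le i\le r},(\phi_i)_{1\le i\le r})$ of vector bundles $\mathcal E_i$ on $C$ and morphisms of $\mathcal O_C$-modules $\phi_i\colon\mathcal E_i\to\mathcal E_{i-1}$; its rank is $(\operatorname{rk}\mathcal E_i)_i$ and its degree is $(\deg\mathcal E_i)_i$. A subchain of $\mathcal E_\bullet$ is a chain $\mathcal E'_\bullet$ of subsheaves $\mathcal E'_i\subseteq\mathcal E_i$ with $\phi_i(\mathcal E'_i)\subseteq\mathcal E'_{i-1}$. For $\alpha=(\alpha_0,\dots,\alpha_r)\in\mathbb R^{r+1}$ the $\alpha$-slope of a nonzero chain is $$\mu_\alpha(\mathcal E_\bullet)=\sum_{i=0}^r\frac{\operatorname{rk}\mathcal E_i}{\sum_j\operatorname{rk}\mathcal E_j}\Big(\frac{\deg\mathcal E_i}{\operatorname{rk}\mathcal E_i}+\alpha_i\Big),$$ where a summand with $\operatorname{rk}\mathcal E_i=0$ is read as $0$. A chain $\mathcal E_\bullet$ is $\alpha$-semistable if $\mu_\alpha(\mathcal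 E'_\bullet)\le\mu_\alpha(\mathcal E_\bullet)$ for every nonzero subchain $\mathcal E'_\bullet\subseteq\mathcal E_\bullet$. A Harder–Narasimhan flag of $\mathcal E_\bullet$ is a flag of subchains $0=\mathcal E^0_\bullet\subset\mathcal E^1_\bullet\subset\dots\subset\mathcal E^h_\bullet=\mathcal E_\bullet$ whose subquotients $\mathcal E^j_\bullet/\mathcal E^{j-1}_\bullet$ are nonzero $\alpha$-semistable chains (of vector bundles) with strictly decreasing $\alpha$-slopes. Fix $n,r\in\mathbb N$, integers $d_r\le d_{r-1}\le\dots\le d_0$ and $\alpha\in\mathbb R^{r+1}$, and suppose that $d_{i-1}-d_i<\alpha_i-\alpha_{i-1}$ for all $1\le i\le r$. Let $\mathcal E_\bullet$ be a chain on $C$ of rank $(n,\dots,n)$ and degree $(d_0,\dots,d_r)$. 1. If $\mathcal E_\bullet$ is $\alpha$-semistable, then all $\phi_i$ are injective, and hence also generically surjective (surjective at the generic point of $C$). 2. If all $\phi_i$ are generically surjective and $\mathcal E^1_\bullet\subset\dots\subset\mathcal E^h_\bullet=\mathcal E_\bullet$ is the Harder–Narasimhan flag of $\mathcal E_\bullet$,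 then for every $j$ there is $m_j\in\mathbb N$ with $\operatorname{rk}(\mathcal E^j_\bullet/\mathcal E^{j-1}_\bullet)=(m_j,\dots,m_j)$. -/

import Mathlib

open CategoryTheory AlgebraicGeometry

universe u

noncomputable section

/-- A smooth projective geometrically connected curve over a field `k`. (For smooth curves over a
field, proper and projective are the same; integrality is automatic, and is part of the usual
definition of a curve.) -/
structure SmoothProjectiveCurve (k : Type u) [Field k] where
  /-- the underlying scheme -/
  X : Scheme.{u}
  /-- the structure morphism -/
  hom : X ⟶ Spec (.of k)
  isIntegral : IsIntegral X
  isProper : IsProper hom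
  smooth : SmoothOfRelativeDimension 1 hom
  geometricallyConnected : GeometricallyConnected hom

namespace SmoothProjectiveCurve

variable {k : Type u} [Field k] (C : SmoothProjectiveCurve k)

instance : IsIntegral C.X := C.isIntegral
instance : IsProper C.hom := C.isProper
instance : SmoothOfRelativeDimension 1 C.hom := C.smooth
instance : GeometricallyConnected C.hom := C.geometricallyConnected
instance : IsLocallyNoetherian C.X := LocallyOfFiniteType.isLocallyNoetherian C.hom

/-- The inclusion of `k` into the residue field of a point. -/
def toResidueField (x : C.X) : k →+* C.X.residueField x :=
  ((Scheme.ΓSpecIso (.of k)).inv ≫ C.hom.appTop ≫ C.X.Γevaluation x).hom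

/-- The degree `[κ(x) : k]` of a (closed) point. -/
def pointDegree (x : C.X) : ℕ :=
  letI : Algebra k (C.X.residueField x) := (C.toResidueField x).toAlgebra
  Module.finrank k (C.X.residueField x)

end SmoothProjectiveCurve

section Frames

variable {X : Scheme.{u}}

/-- Restriction of sections of a sheaf of modules. -/
def resSection (M : X.Modules) {U V : X.Opens} (h : V ≤ U) (s : Γ(M, U)) : Γ(M, V) :=
  M.presheaf.map (homOfLE h).op s

/-- A frame of `M` over `U`: sections `s₁, …, sₙ` over `U` whose restrictions to every open `V ⊆ U`
are a basis of `Γ(M, V)` over `Γ(X, V)`, i.e. which define an isomorphism `𝒪ⁿ ≅ M` over `U`. -/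
structure IsFrame (M : X.Modules) {n : ℕ} (U : X.Opens) (s : Fin n → Γ(M, U)) : Prop where
  linearIndependent : ∀ (V : X.Opens) (h : V ≤ U),
    LinearIndependent Γ(X, V) (fun i => resSection M h (s i))
  span_eq_top : ∀ (V : X.Opens) (h : V ≤ U),
    Submodule.span Γ(X, V) (Set.range fun i => resSection M h (s i)) = ⊤

/-- The basis of `Γ(M, V)` given by a frame over `U ⊇ V`. -/
def IsFrame.basis {M : X.Modules} {n : ℕ} {U : X.Opens} {s : Fin n → Γ(M, U)}
    (hs : IsFrame M U s) {V : X.Opens} (h : V ≤ U) : Module.Basis (Fin n) Γ(X, V) Γ(M, V) :=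
  Module.Basis.mk (hs.linearIndependent V h) (hs.span_eq_top V h).ge

end Frames

/-- A vector bundle on the curve `C`: a sheaf of `𝒪`-modules which is locally free of finite
rank. As `C` is connected and nonempty the rank is a constant, determined by the sheaf. -/
structure CurveBundle {k : Type u} [Field k] (C : SmoothProjectiveCurve k) where
  /-- the sheaf of `𝒪`-modules -/
  sheaf : C.X.Modules
  /-- the rank -/
  rank : ℕ
  exists_frame : ∀ x : C.X, ∃ U : C.X.Opens, x ∈ U ∧
    ∃ s : Fin rank → Γ(sheaf, U), IsFrame sheaf U s

namespace CurveBundle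

variable {k : Type u} [Field k] {C : SmoothProjectiveCurve k} (E : CurveBundle C)

/-- An open neighbourhood of `x` on which `E` has a frame. -/
def nhd (x : C.X) : C.X.Opens := (E.exists_frame x).choose

lemma mem_nhd (x : C.X) : x ∈ E.nhd x := (E.exists_frame x).choose_spec.1

/-- A frame of `E` in a neighbourhood of `x`. -/
def frame (x : C.X) : Fin E.rank → Γ(E.sheaf, E.nhd x) :=
  (E.exists_frame x).choose_spec.2.choose

lemma isFrame_frame (x : C.X) : IsFrame E.sheaf (E.nhd x) (E.frame x) :=
  (E.exists_frame x).choose_spec.2.choose_spec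

lemma nonempty_inf (x : C.X) :
    Nonempty (E.nhd (genericPoint C.X) ⊓ E.nhd x : C.X.Opens).toScheme :=
  ⟨⟨genericPoint C.X, E.mem_nhd _,
    ((genericPoint_spec C.X).mem_open_set_iff (E.nhd x).isOpen).mpr
      ⟨x, Set.mem_univ _, E.mem_nhd x⟩⟩⟩

/-- Let `s` be the frame of `E` chosen at the generic point and `t` the frame chosen at `x`.
This is the rational function `g` with `s₁ ∧ ⋯ ∧ sₙ = g • t₁ ∧ ⋯ ∧ tₙ`. -/
def detTransition (x : C.X) : C.X.functionField :=
  haveI := E.nonempty_inf x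
  C.X.germToFunctionField (E.nhd (genericPoint C.X) ⊓ E.nhd x)
    (((E.isFrame_frame x).basis inf_le_right).det
      (fun i => resSection E.sheaf inf_le_left (E.frame (genericPoint C.X) i)))

/-- The degree of a vector bundle: the degree `∑ₓ ordₓ(σ) [κ(x) : k]` of the divisor of a nonzero
rational section `σ = s₁ ∧ ⋯ ∧ sₙ` of its determinant line bundle. The sum is over the closed
points, `Scheme.ord` being zero at the generic point. -/
def degree : ℤ :=
  ∑ᶠ x : C.X, C.X.ord (E.detTransition x) x * (C.pointDegree x : ℤ)

end CurveBundle

/-- A morphism of sheaves of modules on an irreducible scheme is generically surjective if it is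
surjective on stalks at the generic point. -/
def GenericallySurjective {X : Scheme.{u}} [IrreducibleSpace X] {M N : X.Modules}
    (f : M ⟶ N) : Prop :=
  Function.Surjective
    ((TopCat.Presheaf.stalkFunctor Ab (genericPoint X)).map (Scheme.Modules.Hom.mapPresheaf f))

/-- A chain `E_r ⟶ ⋯ ⟶ E_1 ⟶ E_0` of vector bundles on `C`. -/
structure BundleChain {k : Type u} [Field k] (C : SmoothProjectiveCurve k) (r : ℕ) where
  /-- the vector bundles `E_0, …, E_r` -/
  E : Fin (r + 1) → CurveBundle C
  /-- `φ i` is the map `φ_{i+1} : E_{i+1} ⟶ E_i` -/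
  φ : ∀ i : Fin r, (E i.succ).sheaf ⟶ (E i.castSucc).sheaf

namespace BundleChain

variable {k : Type u} [Field k] {C : SmoothProjectiveCurve k} {r : ℕ}

/-- Morphisms of chains. -/
structure Hom (E F : BundleChain C r) where
  app : ∀ i, (E.E i).sheaf ⟶ (F.E i).sheaf
  comm : ∀ i : Fin r, E.φ i ≫ app i.castSucc = app i.succ ≫ F.φ i

/-- `|rk E| = ∑ᵢ rk Eᵢ`. -/
def totalRank (E : BundleChain C r) : ℕ := ∑ i, (E.E i).rank

/-- The `α`-slope `∑ᵢ (rk Eᵢ / |rk E|) (deg Eᵢ / rk Eᵢ + αᵢ)`; a summand with `rk Eᵢ = 0` is `0`. -/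
def slope (α : Fin (r + 1) → ℝ) (E : BundleChain C r) : ℝ :=
  ∑ i, ((E.E i).rank : ℝ) / (E.totalRank : ℝ) *
    (((E.E i).degree : ℝ) / ((E.E i).rank : ℝ) + α i)

/-- `E` is `α`-semistable if `μ(E') ≤ μ(E)` for all nonzero subchains `E' ⊆ E`, a subchain being
a chain with a morphism to `E` all of whose components are injective. (For `E' = E` the inequality
is an equality, so only proper subchains matter.) -/
def IsSemistable (α : Fin (r + 1) → ℝ) (E : BundleChain C r) : Prop :=
  ∀ (E' : BundleChain C r) (ι : Hom E' E), (∀ i, Mono (ι.app i)) → E'.totalRank ≠ 0 →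
    slope α E' ≤ slope α E

/-- A Harder–Narasimhan flag `0 = F_0 ⊂ F_1 ⊂ ⋯ ⊂ F_h = E` of a chain: the subquotients
`G_j = F_{j+1} / F_j` are nonzero `α`-semistable chains of strictly decreasing slopes. -/
structure HNFlag (α : Fin (r + 1) → ℝ) (E : BundleChain C r) where
  /-- the length of the flag -/
  h : ℕ
  /-- the steps of the flag -/
  F : Fin (h + 1) → BundleChain C r
  /-- the subquotients -/
  G : Fin h → BundleChain C r
  /-- the inclusion of a step in the next one -/
  incl : ∀ j : Fin h, Hom (F j.castSucc) (F j.succ)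
  /-- the projection to the subquotient -/
  proj : ∀ j : Fin h, Hom (F j.succ) (G j)
  shortExact : ∀ (j : Fin h) (i : Fin (r + 1)),
    ∃ w : (incl j).app i ≫ (proj j).app i = 0, (ShortComplex.mk _ _ w).ShortExact
  bot_eq : (F 0).totalRank = 0
  top_eq : F (Fin.last h) = E
  ne_zero : ∀ j, (G j).totalRank ≠ 0
  semistable : ∀ j, IsSemistable α (G j)
  slope_strictAnti : StrictAnti fun j => slope α (G j)

end BundleChain

end

/-! A nonzero rational function `g` on `C` has as many zeros as poles: approximating prescribed
jets along the zeros of `g` by elements of the Riemann–Roch spaces `L(mD)`, with `D` the divisor of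
poles of `g`, bounds the degree of the zeros by that of the poles, and `g⁻¹` gives the converse.
Hence the degree of a bundle does not depend on the choice of frames and is additive in short exact
sequences.

Let `K` and `I ⊆ G_{i-1}` be the kernel and the image of `φ_i` on a semistable chain `G` of slope
`μ`. The subchain with the single bundle `K` in degree `i`, and the subchain obtained from `G` by
replacing `G_{i-1}` with `I`, both have slope at most `μ`. Adding the two inequalities gives
`rk K (α_i - α_{i-1}) ≤ deg G_{i-1} - deg G_i + (rk G_i - rk G_{i-1}) (μ - α_{i-1})`.
When the ranks agree, the gap condition on `α` leaves only `K = 0`. For the second part, sum this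
over the subquotients of the flag: as `φ_i` is injective on each step of the flag and the slopes
decrease, summation by parts shows that the contribution of the rank differences is nonpositive, so
again all the kernels vanish. Then the rank differences of the subquotients have a constant sign and
add up to zero. -/

section RelativeLength

variable {R M N : Type*} [Ring R] [AddCommGroup M] [Module R M] [AddCommGroup N] [Module R N]

/-- The length of `B / (A ∩ B)`; over a field, the codimension of `A` in `B`. -/
noncomputable def relLength (A B : Submodule R M) : ℕ∞ :=
  Module.length R (↥B ⧸ A.submoduleOf B)

lemma relLength_add_relLength {A B D : Submodule R M} (hAB : A ≤ B) (hBD : B ≤ D) :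
    relLength A B + relLength B D = relLength A D := by
  let f : (↥B ⧸ A.submoduleOf B) →ₗ[R] ↥D ⧸ A.submoduleOf D :=
    Submodule.mapQ _ _ (Submodule.inclusion hBD) fun _ h => h
  let g : (↥D ⧸ A.submoduleOf D) →ₗ[R] ↥D ⧸ B.submoduleOf D :=
    Submodule.factor (Submodule.comap_mono hAB)
  refine (Module.length_eq_add_of_exact f g ?_ (Submodule.factor_surjective _) ?_).symm
  · exact LinearMap.ker_eq_bot.mp
      ((Submodule.ker_mapQ _ _ _ _).trans (Submodule.mkQ_map_self (A.submoduleOf B)))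
  · refine LinearMap.exact_iff.mpr (((Submodule.ker_mapQ _ _ LinearMap.id _).trans ?_).trans
      (Submodule.range_mapQ _ _ _ _).symm)
    rw [Submodule.range_inclusion]
    rfl

lemma length_add_relLength {A B : Submodule R M} (hAB : A ≤ B) :
    Module.length R A + relLength A B = Module.length R B := by
  rw [← (Submodule.submoduleOfEquivOfLe hAB).length_eq]
  exact (Module.length_eq_add_of_exact (A.submoduleOf B).subtype (A.submoduleOf B).mkQ
    (Submodule.subtype_injective _) (Submodule.mkQ_surjective _)
    (LinearMap.exact_subtype_mkQ _)).symm

lemma relLength_self (A : Submodule R M) : relLength A A = 0 := by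
  rw [relLength, Module.length_eq_zero_iff, Submodule.Quotient.subsingleton_iff,
    Submodule.submoduleOf_self]

lemma relLength_map_equiv (e : M ≃ₗ[R] N) (A B : Submodule R M) :
    relLength (A.map (e : M →ₗ[R] N)) (B.map (e : M →ₗ[R] N)) = relLength A B := by
  refine (Submodule.Quotient.equiv _ _ (e.submoduleMap B) ?_).length_eq.symm
  ext ⟨_, m, hm, rfl⟩
  simp [Submodule.submoduleOf]

section Smul

open scoped Pointwise

variable {α : Type*} [Monoid α] [DistribMulAction α M] [SMulCommClass α R M] {a : α}

lemma length_smul (ha : IsUnit a) (A : Submodule R M) :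
    Module.length R ↥(a • A) = Module.length R A :=
  ((DistribMulAction.toLinearEquiv R M ha.unit).submoduleMap A).length_eq.symm

lemma relLength_smul (ha : IsUnit a) (A B : Submodule R M) :
    relLength (a • A) (a • B) = relLength A B :=
  relLength_map_equiv (DistribMulAction.toLinearEquiv R M ha.unit) A B

end Smul

section Pi

variable {ι : Type*} [Fintype ι] {A B : ι → Submodule R M}

lemma relLength_le_sum {U V : Submodule R M} (hV : ∀ i, V ≤ B i) (hU : V ⊓ ⨅ i, A i ≤ U) :
    relLength U V ≤ ∑ i, relLength (A i) (B i) := by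
  let f : V →ₗ[R] Π i, ↥(B i) ⧸ (A i).submoduleOf (B i) :=
    LinearMap.pi fun i => ((A i).submoduleOf (B i)).mkQ ∘ₗ Submodule.inclusion (hV i)
  have hf : LinearMap.ker f ≤ U.submoduleOf V := fun x hx => hU
    ⟨x.2, (Submodule.mem_iInf _).mpr fun i =>
      ((A i).submoduleOf (B i)).ker_mkQ.le (congr_fun (LinearMap.mem_ker.mp hx) i)⟩
  calc relLength U V ≤ Module.length R (V ⧸ LinearMap.ker f) :=
        Module.length_le_of_surjective _ (Submodule.factor_surjective hf)
    _ ≤ Module.length R (Π i, ↥(B i) ⧸ (A i).submoduleOf (B i)) :=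
        Module.length_le_of_injective _
          (LinearMap.ker_eq_bot.mp (Submodule.ker_liftQ_eq_bot _ f le_rfl le_rfl))
    _ = ∑ i, relLength (A i) (B i) := Module.length_pi_of_fintype R _

/-- A module of finite length is a noetherian module, so an increasing union exhausting it is
attained at a finite stage. -/
lemma exists_sum_relLength_le (hAB : ∀ i, relLength (A i) (B i) ≠ ⊤) {W : ℕ → Submodule R M}
    (hW : Monotone W) (hWB : ∀ m i, W m ≤ B i)
    (happrox : ∀ b : ι → M, (∀ i, b i ∈ B i) → ∃ m, ∃ u ∈ W m, ∀ i, u - b i ∈ A i) :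
    ∃ m, ∀ U : Submodule R M, (∀ i, U ≤ A i) → ∑ i, relLength (A i) (B i) ≤ relLength U (W m) := by
  let f (m : ℕ) : W m →ₗ[R] Π i, ↥(B i) ⧸ (A i).submoduleOf (B i) :=
    LinearMap.pi fun i => ((A i).submoduleOf (B i)).mkQ ∘ₗ Submodule.inclusion (hWB m i)
  have hnoeth (i) : IsNoetherian R (↥(B i) ⧸ (A i).submoduleOf (B i)) :=
    (isFiniteLength_iff_isNoetherian_isArtinian.mp (Module.length_ne_top_iff.mp (hAB i))).1
  have hmono : Monotone fun m => LinearMap.range (f m) := by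
    rintro m m' hm _ ⟨u, rfl⟩
    exact ⟨Submodule.inclusion (hW hm) u, rfl⟩
  obtain ⟨m, hm : ∀ m', m ≤ m' → LinearMap.range (f m) = LinearMap.range (f m')⟩ :=
    monotone_stabilizes_iff_noetherian.mpr inferInstance ⟨_, hmono⟩
  have hsurj : Function.Surjective (f m) := by
    intro q
    choose b hb using fun i => Submodule.mkQ_surjective _ (q i)
    obtain ⟨m', u, hu, hub⟩ := happrox (fun i => b i) fun i => (b i).2
    have hq : q ∈ LinearMap.range (f m') := ⟨⟨u, hu⟩, funext fun i => by
      rw [← hb i]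
      exact (Submodule.Quotient.eq _).mpr (hub i)⟩
    exact (hm _ (le_max_left m m')).ge (hmono (le_max_right m m') hq)
  refine ⟨m, fun U hU => ?_⟩
  have hker : U.submoduleOf (W m) ≤ LinearMap.ker (f m) := fun x hx =>
    funext fun i => (Submodule.Quotient.mk_eq_zero _).mpr (hU i hx)
  calc ∑ i, relLength (A i) (B i)
      = Module.length R (Π i, ↥(B i) ⧸ (A i).submoduleOf (B i)) :=
        (Module.length_pi_of_fintype R _).symm
    _ ≤ relLength U (W m) := Module.length_le_of_surjective (Submodule.liftQ _ (f m) hker)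
        (LinearMap.range_eq_top.mp
          ((Submodule.range_liftQ _ _ _).trans (LinearMap.range_eq_top.mpr hsurj)))

end Pi

end RelativeLength

section WeakApproximation

open WithZero

variable {K : Type*} [Field K]

/-- The real absolute value `2 ^ (-ord)` attached to a discrete valuation. -/
noncomputable def intAbv (v : Valuation K ℤᵐ⁰) : AbsoluteValue K ℝ where
  toFun f := WithZeroMulInt.toNNReal two_ne_zero (v f)
  map_mul' f g := by simp
  nonneg' f := NNReal.coe_nonneg _
  eq_zero' f := by simp
  add_le' f g := by
    have hmono := (WithZeroMulInt.toNNReal_strictMono (e := 2) one_lt_two).monotone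
    refine (NNReal.coe_le_coe.mpr ((hmono (v.map_add f g)).trans_eq (hmono.map_max))).trans ?_
    rw [NNReal.coe_max]
    exact max_le_add_of_nonneg (NNReal.coe_nonneg _) (NNReal.coe_nonneg _)

lemma intAbv_lt_iff {v : Valuation K ℤᵐ⁰} {f : K} {γ : ℤᵐ⁰} :
    intAbv v f < WithZeroMulInt.toNNReal (e := 2) two_ne_zero γ ↔ v f < γ :=
  NNReal.coe_lt_coe.trans (WithZeroMulInt.toNNReal_strictMono one_lt_two).lt_iff_lt

lemma intAbv_le_one_iff {v : Valuation K ℤᵐ⁰} {f : K} : intAbv v f ≤ 1 ↔ v f ≤ 1 :=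
  NNReal.coe_le_one.trans (WithZeroMulInt.toNNReal_le_one_iff one_lt_two)

lemma exists_forall_valuation_sub_lt {ι : Type*} [Finite ι] {v : ι → Valuation K ℤᵐ⁰}
    (hv : ∀ i, (v i).IsNontrivial) (hne : Pairwise fun i j => ∃ f, v i f ≤ 1 ∧ 1 < v j f)
    (a : ι → K) {γ : ι → ℤᵐ⁰} (hγ : ∀ i, γ i ≠ 0) : ∃ b, ∀ i, v i (b - a i) < γ i := by
  have hv' (i) : (intAbv (v i)).IsNontrivial := by
    obtain ⟨f, hf⟩ := (hv i).exists_one_lt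
    have hf' : ¬ intAbv (v i) f ≤ 1 := intAbv_le_one_iff.not.mpr hf.not_ge
    exact ⟨f, fun h0 => hf' (by simp [h0]), fun h1 => hf' h1.le⟩
  have hne' : Pairwise fun i j => ¬ (intAbv (v i)).IsEquiv (intAbv (v j)) := fun i j hij he => by
    obtain ⟨f, hi, hj⟩ := hne hij
    exact hj.not_ge (intAbv_le_one_iff.mp (he.le_one_iff.mp (intAbv_le_one_iff.mpr hi)))
  let r (i) : ℝ := WithZeroMulInt.toNNReal (e := 2) two_ne_zero (γ i)
  have hr (i) : 0 < r i :=
    NNReal.coe_pos.mpr (WithZeroMulInt.toNNReal_pos two_ne_zero (hγ i))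
  obtain ⟨b, hb⟩ := (AbsoluteValue.denseRange_algebraMap_pi hv' hne').exists_mem_open
    (isOpen_set_pi Set.finite_univ fun i _ =>
      Metric.isOpen_ball (x := WithAbs.toAbs (intAbv (v i)) (a i)) (ε := r i))
    ⟨_, fun i _ => Metric.mem_ball_self (hr i)⟩
  exact ⟨b, fun i => intAbv_lt_iff.mp (mem_ball_iff_norm.mp (hb i trivial))⟩

end WeakApproximation

section ProductFormula

open WithZero Polynomial
open scoped Pointwise

variable {K S : Type*} (k : Type*) [Field k] [Field K] [Algebra k K]

/-- The elements with `v f ≤ exp n`, i.e. with a pole of order at most `n`. -/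
def valFilt (v : Valuation K ℤᵐ⁰) [v.IsTrivialOn k] (n : ℤ) : Submodule k K where
  carrier := {f | v f ≤ exp n}
  add_mem' := v.map_add_le
  zero_mem' := by simp
  smul_mem' c f hf := by
    rw [Set.mem_ofPred_eq, Algebra.smul_def, map_mul]
    exact (mul_le_of_le_one_left' (Valuation.IsTrivialOn.valuation_algebraMap_le_one v c)).trans hf

/-- A family of discrete valuations of `K / k` with residue fields of degrees `d`, with the
finiteness properties of the closed points of a proper curve with function field `K`. -/
structure IsProperPlaceFamily (v : S → Valuation K ℤᵐ⁰) [∀ x, (v x).IsTrivialOn k]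
    (d : S → ℕ) : Prop where
  uniformizer : ∀ x, ∃ π : K, v x π = exp (-1)
  residue : ∀ x, relLength (valFilt k (v x) (-1)) (valFilt k (v x) 0) = d x
  finite : ∀ f : K, f ≠ 0 → {x | v x f ≠ 1}.Finite
  incomparable : Pairwise fun x y => ∃ f : K, v x f ≤ 1 ∧ 1 < v y f
  global : Module.length k (⨅ x, valFilt k (v x) 0 : Submodule k K) ≠ ⊤

/-- The Riemann–Roch space `L(D)` of the elements whose poles are bounded by the divisor `D`. -/
def riemannRoch (v : S → Valuation K ℤᵐ⁰) [∀ x, (v x).IsTrivialOn k] (D : S → ℤ) :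
    Submodule k K :=
  ⨅ x, valFilt k (v x) (D x)

variable {k} {v : S → Valuation K ℤᵐ⁰} {d : S → ℕ}

lemma mem_valFilt {v : Valuation K ℤᵐ⁰} [v.IsTrivialOn k] {n : ℤ} {f : K} :
    f ∈ valFilt k v n ↔ v f ≤ exp n := Iff.rfl

lemma valFilt_mono (v : Valuation K ℤᵐ⁰) [v.IsTrivialOn k] : Monotone (valFilt k v) :=
  fun _ _ h _ hf => le_trans hf (exp_le_exp.mpr h)

lemma smul_valFilt (v : Valuation K ℤᵐ⁰) [v.IsTrivialOn k] {g : K} (hg : g ≠ 0) (n : ℤ) :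
    g • valFilt k v n = valFilt k v (n + log (v g)) := by
  have hvg : v g ≠ 0 := v.ne_zero_iff.mpr hg
  ext f
  rw [← SetLike.mem_coe, Submodule.coe_pointwise_smul, Set.mem_smul_set_iff_inv_smul_mem₀ hg,
    SetLike.mem_coe, mem_valFilt, mem_valFilt, smul_eq_mul, map_mul, map_inv₀,
    inv_mul_le_iff₀ (zero_lt_iff.mpr hvg), exp_add, exp_log hvg, mul_comm]

lemma valuation_aeval_le_one (v : Valuation K ℤᵐ⁰) [v.IsTrivialOn k] {g : K} (hg : v g ≤ 1)
    (p : k[X]) : v (aeval g p) ≤ 1 := by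
  induction p using Polynomial.induction_on' with
  | add p q hp hq => exact (map_add (aeval g) p q).symm ▸ v.map_add_le hp hq
  | monomial n a =>
    rw [aeval_monomial, map_mul, map_pow]
    exact mul_le_one' (Valuation.IsTrivialOn.valuation_algebraMap_le_one v a) (pow_le_one' hg n)

lemma valuation_aeval_sub_one_le (v : Valuation K ℤᵐ⁰) [v.IsTrivialOn k] {g : K} (hg : v g ≤ 1)
    {p : k[X]} (hp : p.coeff 0 = 1) : v (aeval g p - 1) ≤ v g := by
  obtain ⟨r, hr⟩ : X ∣ p - 1 := X_dvd_iff.mpr (by simp [hp])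
  have hpg : aeval g p - 1 = g * aeval g r := by
    simpa using congr_arg (aeval g) hr
  rw [hpg, map_mul]
  exact mul_le_of_le_one_right' (valuation_aeval_le_one v hg r)

/-- The multiplicity of `x` in the divisor of poles of `g`. -/
noncomputable def poleOrder (v : S → Valuation K ℤᵐ⁰) (g : K) (x : S) : ℕ := (log (v x g)).toNat

lemma poleOrder_eq_zero {g : K} {x : S} (hx : v x g ≤ 1) : poleOrder v g x = 0 := by
  obtain h0 | h0 := eq_or_ne (v x g) 0
  · simp [poleOrder, h0]
  · rw [poleOrder, Int.toNat_eq_zero, ← log_one, log_le_log h0 one_ne_zero]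
    exact hx

lemma log_eq_poleOrder_sub (g : K) (x : S) :
    log (v x g) = poleOrder v g x - poleOrder v g⁻¹ x := by
  rw [poleOrder, poleOrder, map_inv₀, log_inv, Int.toNat_sub_toNat_neg]

lemma log_eq_neg_poleOrder_inv {g : K} {x : S} (hx : v x g ≤ 1) :
    log (v x g) = -poleOrder v g⁻¹ x := by
  simp [log_eq_poleOrder_sub, poleOrder_eq_zero hx]

variable [∀ x, (v x).IsTrivialOn k]

lemma mem_riemannRoch {D : S → ℤ} {f : K} :
    f ∈ riemannRoch k v D ↔ ∀ x, v x f ≤ exp (D x) := by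
  simp [riemannRoch, Submodule.mem_iInf, mem_valFilt]

lemma riemannRoch_mono : Monotone (riemannRoch k v) :=
  fun _ _ h => iInf_mono fun x => valFilt_mono (v x) (h x)

lemma smul_riemannRoch {g : K} (hg : g ≠ 0) (D : S → ℤ) :
    g • riemannRoch k v D = riemannRoch k v fun x => D x + log (v x g) := by
  refine SetLike.coe_injective ?_
  simp only [riemannRoch, ← smul_valFilt _ hg, Submodule.coe_pointwise_smul, Submodule.coe_iInf]
  exact Set.image_iInter (mulLeft_bijective₀ g hg) _

namespace IsProperPlaceFamily

variable (h : IsProperPlaceFamily k v d)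
include h

lemma relLength_valFilt (x : S) (a : ℤ) (n : ℕ) :
    relLength (valFilt k (v x) a) (valFilt k (v x) (a + n)) = (n * d x : ℕ) := by
  obtain ⟨π, hπ⟩ := h.uniformizer x
  have hπ0 : π ≠ 0 := (v x).ne_zero_iff.mp (hπ ▸ exp_ne_zero)
  have hshift (b : ℤ) : relLength (valFilt k (v x) b) (valFilt k (v x) (b + 1)) = d x := by
    rw [← relLength_smul (zpow_ne_zero (b + 1) hπ0).isUnit, smul_valFilt _ (zpow_ne_zero _ hπ0),
      smul_valFilt _ (zpow_ne_zero _ hπ0), map_zpow₀, hπ, log_zpow, log_exp, ← h.residue x]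
    congr 2 <;> ring
  induction n with
  | zero => simpa using relLength_self _
  | succ n ih =>
    rw [← relLength_add_relLength (valFilt_mono (k := k) (v x) (by simp : a ≤ a + n))
      (valFilt_mono (v x) (by simp)), ih, Nat.cast_succ, ← add_assoc, hshift]
    push_cast
    ring

lemma relLength_riemannRoch_le (D : S → ℤ) (n : S → ℕ) {s : Finset S} (hs : ∀ x ∉ s, n x = 0) :
    relLength (riemannRoch k v D) (riemannRoch k v fun x => D x + n x) ≤
      (∑ x ∈ s, n x * d x : ℕ) := by
  rw [← Finset.sum_coe_sort, Nat.cast_sum]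
  refine (relLength_le_sum (A := fun x : s => valFilt k (v x) (D x)) (fun x => iInf_le _ x.1)
    fun f hf => mem_riemannRoch.mpr fun x => ?_).trans_eq
    (Finset.sum_congr rfl fun x _ => h.relLength_valFilt x.1 (D x) (n x))
  by_cases hx : x ∈ s
  · exact (Submodule.mem_iInf _).mp hf.2 ⟨x, hx⟩
  · simpa [hs x hx] using mem_riemannRoch.mp hf.1 x

lemma length_riemannRoch_ne_top (n : S → ℕ) {s : Finset S} (hs : ∀ x ∉ s, n x = 0) :
    Module.length k (riemannRoch k v fun x => n x) ≠ ⊤ := by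
  have hle := riemannRoch_mono (k := k) (v := v) (a := 0) fun x => Int.natCast_nonneg (n x)
  rw [← length_add_relLength hle]
  have hrel := h.relLength_riemannRoch_le 0 n hs
  simp only [Pi.zero_apply, zero_add] at hrel
  exact WithTop.add_ne_top.mpr ⟨h.global, ne_top_of_le_ne_top (ENat.natCast_ne_top _) hrel⟩

lemma exists_forall_le_exp (u : K) : ∃ m : ℕ, ∀ x, v x u ≤ exp (m : ℤ) := by
  obtain rfl | hu := eq_or_ne u 0
  · simp
  obtain ⟨m, hm⟩ := ((h.finite u hu).image fun x => (log (v x u)).toNat).bddAbove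
  refine ⟨m, fun x => ?_⟩
  by_cases hx : v x u = 1
  · simp [hx, ← exp_zero]
  · have := hm (Set.mem_image_of_mem _ hx)
    rw [← log_le_iff_le_exp ((v x).ne_zero_iff.mpr hu)]
    omega

lemma exists_valuation_aeval_le {g : K} {y : S} (hy : v y g = 1) :
    ∃ q : k[X], q.coeff 0 = 1 ∧ v y (aeval g q) ≤ exp (-1) := by
  let φ : k[X] →ₗ[k] ↥(valFilt k (v y) 0) ⧸ (valFilt k (v y) (-1)).submoduleOf _ :=
    Submodule.mkQ _ ∘ₗ LinearMap.codRestrict _ (aeval g).toLinearMap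
      fun p => valuation_aeval_le_one (v y) hy.le p
  have hφ : ¬ Function.Injective φ := fun hinj => by
    have hlen : Module.length k k[X] ≠ ⊤ := ne_top_of_le_ne_top
      (ENat.natCast_ne_top (d y)) (h.residue y ▸ Module.length_le_of_injective φ hinj)
    rw [Module.length_ne_top_iff, isFiniteLength_iff_isNoetherian_isArtinian] at hlen
    have := hlen.1
    exact Polynomial.not_finite (inferInstance : Module.Finite k k[X])
  obtain ⟨p, hp, hp0⟩ := (Submodule.ne_bot_iff _).mp (LinearMap.ker_eq_bot.not.mpr hφ)
  obtain ⟨q, hpq, hq⟩ := p.exists_eq_pow_rootMultiplicity_mul_and_not_dvd hp0 0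
  rw [map_zero, sub_zero, X_dvd_iff] at hq
  have hvp : v y (aeval g p) ≤ exp (-1) :=
    ((valFilt k (v y) (-1)).submoduleOf _).ker_mkQ.le (x := ⟨_, _⟩) hp
  refine ⟨C (q.coeff 0)⁻¹ * q, by simp [hq], ?_⟩
  rw [hpq] at hvp
  simpa [hy, Valuation.IsTrivialOn.eq_one _ hq] using hvp


lemma exists_aeval_mul_le_one {c : K} (hc : c ≠ 0) (g : K) :
    ∃ p : k[X], p.coeff 0 = 1 ∧ ∀ y, v y g = 1 → v y (aeval g p * c) ≤ 1 := by
  classical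
  choose! q hq0 hq using fun y (hy : v y g = 1) => h.exists_valuation_aeval_le hy
  let s := (h.finite c hc).toFinset.filter fun y => v y g = 1
  have hs {y : S} : y ∈ s ↔ v y c ≠ 1 ∧ v y g = 1 := by simp [s]
  refine ⟨∏ y ∈ s, q y ^ (log (v y c)).toNat, ?_, fun y hy => ?_⟩
  · rw [coeff_zero_prod]
    refine Finset.prod_eq_one fun y hy => ?_
    rw [coeff_zero_eq_eval_zero, eval_pow, ← coeff_zero_eq_eval_zero, hq0 y (hs.mp hy).2, one_pow]
  have hle (p : k[X]) : v y (aeval g p) ≤ 1 := valuation_aeval_le_one (v y) hy.le p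
  by_cases hcy : v y c ≤ 1
  · exact (map_mul (v y) _ _).trans_le (mul_le_one' (hle _) hcy)
  have hlog : 0 ≤ log (v y c) := by
    rw [← log_one, log_le_log one_ne_zero ((v y).ne_zero_iff.mpr hc)]
    exact (not_le.mp hcy).le
  rw [← Finset.mul_prod_erase s _ (hs.mpr ⟨fun h1 => hcy h1.le, hy⟩), map_mul (aeval g),
    mul_right_comm, map_mul]
  refine mul_le_one' ?_ (hle _)
  calc v y (aeval g (q y ^ (log (v y c)).toNat) * c)
      ≤ exp (-1) ^ (log (v y c)).toNat * v y c := by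
        rw [map_pow, map_mul, map_pow]
        gcongr
        exact hq y hy
    _ = exp (-log (v y c)) * exp (log (v y c)) := by
        rw [← exp_nsmul, exp_log ((v y).ne_zero_iff.mpr hc), nsmul_eq_mul, Int.toNat_of_nonneg hlog,
          mul_neg_one]
    _ = 1 := by rw [← exp_add, neg_add_cancel, exp_zero]

/-- The first approximation `c` of `b` may have poles anywhere; multiplying it by `p(g)`, where
`p(0) = 1`, keeps the approximation at the zeros of `g` and moves the poles to those of `g`. -/
lemma exists_approx {g : K} (hg : g ≠ 0) (b : {x // v x g < 1} → K)
    (hb : ∀ x, v x.1 (b x) ≤ 1) :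
    ∃ u, (∀ x, v x.1 (u - b x) ≤ v x.1 g) ∧ (∀ y, v y g ≤ 1 → v y u ≤ 1) := by
  have : Finite {x // v x g < 1} := ((h.finite g hg).subset fun x hx => ne_of_lt hx).to_subtype
  have hnontriv (x) : (v x).IsNontrivial := by
    obtain ⟨π, hπ⟩ := h.uniformizer x
    exact ⟨π, by simp [hπ], by rw [hπ, ← exp_zero, Ne, exp_inj]; decide⟩
  obtain ⟨c, hc⟩ := exists_forall_valuation_sub_lt (v := fun x : {x // v x g < 1} => v x)
    (fun x => hnontriv x) (fun x y hxy => h.incomparable (Subtype.coe_injective.ne hxy)) b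
    (γ := fun x => v x g) (fun x => (v x).ne_zero_iff.mpr hg)
  obtain rfl | hc0 := eq_or_ne c 0
  · exact ⟨0, fun x => (hc x).le, by simp⟩
  have hcreg (x : {x // v x g < 1}) : v x c ≤ 1 := by
    rw [← sub_add_cancel c (b x)]
    exact (v x).map_add_le ((hc x).le.trans x.2.le) (hb x)
  obtain ⟨p, hp0, hp⟩ := h.exists_aeval_mul_le_one hc0 g
  refine ⟨aeval g p * c, fun x => ?_, fun y hy => ?_⟩
  · have hsplit : aeval g p * c - b x = (aeval g p - 1) * c + (c - b x) := by ring
    rw [hsplit]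
    refine (v x).map_add_le ?_ (hc x).le
    rw [map_mul]
    exact (mul_le_of_le_one_right' (hcreg x)).trans (valuation_aeval_sub_one_le _ x.2.le hp0)
  · obtain hy | hy := hy.lt_or_eq
    · rw [map_mul]
      exact mul_le_one' (valuation_aeval_le_one _ hy.le p) (hcreg ⟨y, hy⟩)
    · exact hp y hy

lemma exists_approx_mem_riemannRoch {g : K} (hg : g ≠ 0) (b : {x // v x g < 1} → K)
    (hb : ∀ x, v x.1 (b x) ≤ 1) :
    ∃ m : ℕ, ∃ u ∈ riemannRoch k v fun x => (m * poleOrder v g x : ℕ),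
      ∀ x, v x.1 (u - b x) ≤ v x.1 g := by
  obtain ⟨u, hub, hu⟩ := h.exists_approx hg b hb
  obtain ⟨m, hm⟩ := h.exists_forall_le_exp u
  refine ⟨m, u, mem_riemannRoch.mpr fun x => ?_, hub⟩
  by_cases hx : v x g ≤ 1
  · simpa [poleOrder_eq_zero hx] using hu x hx
  refine (hm x).trans (exp_le_exp.mpr (Nat.cast_le.mpr (Nat.le_mul_of_pos_right m ?_)))
  rw [poleOrder, Int.lt_toNat, Nat.cast_zero, ← log_one,
    log_lt_log one_ne_zero ((v x).ne_zero_iff.mpr hg)]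
  exact not_le.mp hx

/-- On `L((m + 1) D)`, for `D` the divisor of poles of `g`, vanishing on the divisor of zeros of
`g` is the same as lying in `g L(m D)`; for large `m` the vanishing conditions are independent. -/
lemma exists_sum_zeros_le_relLength {g : K} (hg : g ≠ 0) [Fintype {x // v x g < 1}] :
    ∃ m : ℕ, ∑ x : {x // v x g < 1}, ((poleOrder v g⁻¹ x * d x : ℕ) : ℕ∞) ≤
      relLength (g • riemannRoch k v fun x => (m * poleOrder v g x : ℕ))
        (riemannRoch k v fun x => ((m + 1) * poleOrder v g x : ℕ)) := by
  let L (m : ℕ) : Submodule k K := riemannRoch k v fun x => (m * poleOrder v g x : ℕ)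
  have hL : Monotone L := fun m m' hm => riemannRoch_mono fun x => by dsimp only; gcongr
  have hlen (x : {x // v x g < 1}) :
      relLength (valFilt k (v x) (log (v x g))) (valFilt k (v x) 0) =
        (poleOrder v g⁻¹ x * d x : ℕ) := by
    simpa [log_eq_neg_poleOrder_inv x.2.le] using
      h.relLength_valFilt x (log (v x g)) (poleOrder v g⁻¹ x)
  have hL0 (m : ℕ) (x : {x // v x g < 1}) : L m ≤ valFilt k (v x) 0 :=
    (iInf_le _ x.1).trans (by simp [poleOrder_eq_zero x.2.le])
  simp only [← hlen]
  obtain ⟨m, hm⟩ := exists_sum_relLength_le (fun x => (hlen x).trans_ne (ENat.natCast_ne_top _))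
    (fun m m' hm => hL (Nat.succ_le_succ hm)) (fun m => hL0 (m + 1)) fun b hb => by
      obtain ⟨m, u, hu, hub⟩ := h.exists_approx_mem_riemannRoch hg b hb
      exact ⟨m, u, hL m.le_succ hu, fun x =>
        (hub x).trans_eq (exp_log ((v x).ne_zero_iff.mpr hg)).symm⟩
  refine ⟨m, hm _ fun x => ?_⟩
  rw [← zero_add (log (v x g)), ← smul_valFilt _ hg]
  exact Submodule.map_mono (hL0 m x)

lemma sum_zeros_le_sum_poles {g : K} (hg : g ≠ 0) {s : Finset S} (hs : ∀ x ∉ s, v x g = 1) :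
    ∑ x ∈ s, poleOrder v g⁻¹ x * d x ≤ ∑ x ∈ s, poleOrder v g x * d x := by
  classical
  have : Fintype {x // v x g < 1} := ((h.finite g hg).subset fun x hx => ne_of_lt hx).fintype
  have hsum : ∑ x ∈ s, poleOrder v g⁻¹ x * d x =
      ∑ x : {x // v x g < 1}, poleOrder v g⁻¹ x * d x := by
    rw [← Finset.sum_filter_of_ne (p := fun x => v x g < 1) fun x _ hx => ?_]
    · refine Finset.sum_subtype _ (fun x => ?_) _
      rw [Finset.mem_filter, and_iff_right_iff_imp]
      exact fun hx => by_contra fun hxs => hx.ne (hs x hxs)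
    · contrapose! hx
      rw [poleOrder_eq_zero (by rw [map_inv₀]; exact inv_le_one_of_one_le₀ hx), zero_mul]
  obtain ⟨m, hm⟩ := h.exists_sum_zeros_le_relLength hg
  set L : ℕ → Submodule k K := fun m => riemannRoch k v fun x => (m * poleOrder v g x : ℕ)
  have hL : L m ≤ L (m + 1) := riemannRoch_mono fun x => by dsimp only; gcongr; exact m.le_succ
  have hgL : g • L m ≤ L (m + 1) := by
    rw [smul_riemannRoch hg]
    refine riemannRoch_mono fun x => ?_
    have := Int.self_le_toNat (log (v x g))
    rw [poleOrder]
    push_cast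
    linarith
  have hfin : Module.length k (L m) ≠ ⊤ := h.length_riemannRoch_ne_top _ (s := s) fun x hx => by
    rw [poleOrder_eq_zero (hs x hx).le, mul_zero]
  rw [hsum, ← Nat.cast_le (α := ℕ∞), ← ENat.add_le_add_iff_left hfin]
  calc Module.length k (L m) + (∑ x : {x // v x g < 1}, poleOrder v g⁻¹ x * d x : ℕ)
      ≤ Module.length k ↥(g • L m) + relLength (g • L m) (L (m + 1)) := by
        rw [length_smul hg.isUnit, Nat.cast_sum]
        gcongr
    _ = Module.length k (L m) + relLength (L m) (L (m + 1)) := by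
        rw [length_add_relLength hgL, length_add_relLength hL]
    _ ≤ Module.length k (L m) + (∑ x ∈ s, poleOrder v g x * d x : ℕ) := by
        gcongr
        simp only [L, add_one_mul, Nat.cast_add]
        exact h.relLength_riemannRoch_le _ _ fun x hx => poleOrder_eq_zero (hs x hx).le

theorem finsum_log_mul_eq_zero {g : K} (hg : g ≠ 0) : ∑ᶠ x, log (v x g) * (d x : ℤ) = 0 := by
  let s := (h.finite g hg).toFinset
  have hs : ∀ x ∉ s, v x g = 1 := fun x hx => by simpa [s] using hx
  have hpoles := h.sum_zeros_le_sum_poles hg hs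
  have hzeros := h.sum_zeros_le_sum_poles (inv_ne_zero hg) (s := s) fun x hx => by
    rw [map_inv₀, hs x hx, inv_one]
  rw [inv_inv] at hzeros
  rw [finsum_eq_sum_of_support_subset (s := s) _ fun x hx => by_contra fun hxs => hx (by
    simp only [hs x hxs, log_one, zero_mul])]
  simp only [log_eq_poleOrder_sub, sub_mul, Finset.sum_sub_distrib]
  exact sub_eq_zero.mpr (mod_cast hzeros.antisymm hpoles)

end IsProperPlaceFamily

end ProductFormula

lemma isPrincipal_maximalIdeal_of_formallyUnramified (A : Type*) {B T : Type*} [CommRing A]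
    [IsPrincipalIdealRing A] [CommRing B] [Algebra A B] [Algebra.FormallyUnramified A B]
    [Algebra.EssFiniteType A B] (q : Ideal B) [q.IsPrime] [CommRing T] [IsLocalRing T]
    [Algebra B T] [IsLocalization.AtPrime T q] : (IsLocalRing.maximalIdeal T).IsPrincipal := by
  let := Localization.AtPrime.algebraOfLiesOver (q.under A) q
  let e : Localization.AtPrime q ≃+* T := (IsLocalization.algEquiv q.primeCompl _ T).toRingEquiv
  rw [← IsLocalRing.map_maximalIdeal_of_surjective e.toRingHom e.surjective,
    ← ((Algebra.isUnramifiedAt_iff_map_eq A (q.under A) q).mp inferInstance).2]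
  infer_instance

lemma lt_one_of_forall_le_one {K Γ Γ' : Type*} [Field K] [LinearOrderedCommGroupWithZero Γ]
    [MulArchimedean Γ] [LinearOrderedCommGroupWithZero Γ'] {v : Valuation K Γ} {w : Valuation K Γ'}
    (hvw : ∀ f, v f ≤ 1 → w f ≤ 1) (hw : ∃ g, 1 < w g) {f : K} (hf : v f < 1) : w f < 1 := by
  obtain ⟨g, hg⟩ := hw
  refine (hvw f hf.le).lt_of_ne fun hwf => ?_
  have hg0 : g ≠ 0 := by
    rintro rfl
    simp at hg
  have hvg : v g ≠ 0 := v.ne_zero_iff.mpr hg0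
  obtain ⟨n, hn⟩ := exists_pow_lt₀ hf (Units.mk0 (v g)⁻¹ (inv_ne_zero hvg))
  have hvfg : v (f ^ n * g) ≤ 1 := by
    rw [map_mul, map_pow]
    exact (mul_le_mul_left hn.le _).trans_eq (inv_mul_cancel₀ hvg)
  exact (hvw _ hvfg).not_gt (by simpa [hwf] using hg)

lemma exists_germToFunctionField_eq {X : Scheme.{u}} [IsIntegral X] {f : X.functionField}
    (hf : ∀ x : X, f ∈ (algebraMap (X.presheaf.stalk x) X.functionField).range) :
    ∃ s : Γ(X, ⊤), X.presheaf.germ ⊤ (genericPoint X) trivial s = f := by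
  have hloc (x : X) : ∃ U : X.Opens, x ∈ U ∧ ∃ (hη : genericPoint X ∈ U) (s : Γ(X, U)),
      X.presheaf.germ U (genericPoint X) hη s = f := by
    obtain ⟨a, rfl⟩ := hf x
    obtain ⟨U, hxU, s, rfl⟩ := X.presheaf.exists_germ_eq a
    have : Nonempty U := ⟨⟨x, hxU⟩⟩
    exact ⟨U, hxU, ((genericPoint_spec X).mem_open_set_iff U.isOpen).mpr ⟨x, trivial, hxU⟩, s,
      (Scheme.algebraMap_germ_eq_germToFunctionField X hxU s).symm⟩
  choose U hxU hη s hs using hloc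
  obtain ⟨t, ht, -⟩ := X.sheaf.existsUnique_gluing' U ⊤ (fun x => homOfLE le_top)
    (fun x _ => TopologicalSpace.Opens.mem_iSup.mpr ⟨x, hxU x⟩) s fun x y => by
      apply germ_injective_of_isIntegral X (U := U x ⊓ U y) (genericPoint X) ⟨hη x, hη y⟩
      refine (TopCat.Presheaf.germ_res_apply _ _ _ _ _).trans
        (Eq.trans ?_ (TopCat.Presheaf.germ_res_apply _ _ _ _ _).symm)
      exact (hs x).trans (hs y).symm
  refine ⟨t, ?_⟩
  rw [← hs (genericPoint X), ← ht (genericPoint X)]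
  exact (TopCat.Presheaf.germ_res_apply _ _ _ _ _).symm

/-- By separatedness, a point is determined by the spectrum of its local ring as a scheme over
`X`, and the latter by its generic point. -/
lemma eq_of_isLocalHom_of_comp_algebraMap_eq {X : Scheme.{u}} [IsIntegral X] [X.IsSeparated]
    {x y : X} (ψ : X.presheaf.stalk x →+* X.presheaf.stalk y) [IsLocalHom ψ]
    (hψ : (algebraMap (X.presheaf.stalk y) X.functionField).comp ψ = algebraMap _ _) : x = y := by
  let spx := X.presheaf.stalkSpecializes (genericPoint_specializes x)
  let spy := X.presheaf.stalkSpecializes (genericPoint_specializes y)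
  have hcomp : CommRingCat.ofHom ψ ≫ spy = spx := CommRingCat.hom_ext hψ
  have hdom : IsDominant (Spec.map spy) := by
    refine ⟨(PrimeSpectrum.denseRange_comap_iff_ker_le_nilRadical spy.hom).mpr ?_⟩
    rw [(RingHom.injective_iff_ker_eq_bot spy.hom).mp
      (IsFractionRing.injective (X.presheaf.stalk y) X.functionField)]
    exact bot_le
  have heq : Spec.map (CommRingCat.ofHom ψ) ≫ X.fromSpecStalk x = X.fromSpecStalk y := by
    refine ext_of_isDominant (Spec.map spy) ?_
    rw [← Spec.map_comp_assoc, hcomp, Scheme.SpecMap_stalkSpecializes_fromSpecStalk,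
      Scheme.SpecMap_stalkSpecializes_fromSpecStalk]
  calc x = X.fromSpecStalk x (IsLocalRing.closedPoint _) := Scheme.fromSpecStalk_closedPoint.symm
    _ = X.fromSpecStalk x (Spec.map (CommRingCat.ofHom ψ) (IsLocalRing.closedPoint _)) :=
        congr_arg _ (IsLocalRing.comap_closedPoint ψ).symm
    _ = X.fromSpecStalk y (IsLocalRing.closedPoint _) := by
        rw [← heq]
        rfl
    _ = y := Scheme.fromSpecStalk_closedPoint

namespace SmoothProjectiveCurve

open WithZero IsLocalRing

variable {k : Type u} [Field k] (C : SmoothProjectiveCurve k)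

lemma isPrincipal_maximalIdeal_stalk (x : C.X) :
    (maximalIdeal (C.X.presheaf.stalk x)).IsPrincipal := by
  obtain ⟨U, hU, V, hV, hxV, e, hf⟩ :=
    SmoothOfRelativeDimension.exists_isStandardSmoothOfRelativeDimension (n := 1) (f := C.hom) x
  obtain rfl : U = ⊤ := by
    ext y
    have : y = C.hom x := Subsingleton.elim (α := PrimeSpectrum k) _ _
    simpa [this] using e hxV
  obtain ⟨g, -, hg⟩ := hf.exists_etale_mvPolynomial
  let : Field Γ(Spec (.of k), ⊤) :=
    ((Scheme.ΓSpecIso (.of k)).commRingCatIsoToRingEquiv.toMulEquiv.isField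
      (Field.toIsField k)).toField
  have : IsPrincipalIdealRing (MvPolynomial (Fin 1) Γ(Spec (.of k), ⊤)) :=
    .of_surjective (MvPolynomial.uniqueAlgEquiv _ (Fin 1)).symm.toRingHom
      (MvPolynomial.uniqueAlgEquiv _ (Fin 1)).symm.surjective
  algebraize [g]
  let : Algebra Γ(C.X, V) (C.X.presheaf.stalk x) := (C.X.presheaf.germ V x hxV).hom.toAlgebra
  have := hV.isLocalization_stalk ⟨x, hxV⟩
  exact isPrincipal_maximalIdeal_of_formallyUnramified
    (MvPolynomial (Fin 1) Γ(Spec (.of k), ⊤)) (hV.primeIdealOf ⟨x, hxV⟩).asIdeal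

lemma le_genericPoint (x : C.X) : x ≤ genericPoint C.X :=
  genericPoint_specializes x

lemma le_antisymm {x y : C.X} (hxy : x ≤ y) (hyx : y ≤ x) : x = y :=
  (Specializes.antisymm (show x ⤳ y from hyx) (show y ⤳ x from hxy)).eq

lemma not_isField_stalk {x : C.X} (hx : x ≠ genericPoint C.X) :
    ¬ IsField (C.X.presheaf.stalk x) := by
  intro hF
  have hdim := ringKrullDim_eq_zero_of_isField hF
  rw [ringKrullDim_stalk_eq_coheight] at hdim
  have hmax : IsMax x := Order.coheight_eq_zero.mp (by exact_mod_cast hdim)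
  exact hx (C.le_antisymm (C.le_genericPoint x) (hmax (C.le_genericPoint x)))

lemma isDiscreteValuationRing_stalk {x : C.X} (hx : x ≠ genericPoint C.X) :
    IsDiscreteValuationRing (C.X.presheaf.stalk x) :=
  ((IsDiscreteValuationRing.TFAE _ (C.not_isField_stalk hx)).out 0 4).mpr
    (C.isPrincipal_maximalIdeal_stalk x)

lemma isPrincipalIdealRing_stalk (x : C.X) : IsPrincipalIdealRing (C.X.presheaf.stalk x) := by
  by_cases hx : x = genericPoint C.X
  · subst hx
    exact inferInstanceAs (IsPrincipalIdealRing C.X.functionField)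
  · have := C.isDiscreteValuationRing_stalk hx
    infer_instance

lemma coheight_eq_one {x : C.X} (hx : x ≠ genericPoint C.X) : Order.coheight x = 1 := by
  have := C.isDiscreteValuationRing_stalk hx
  have hdim := IsDiscreteValuationRing.ringKrullDim_eq_one (C.X.presheaf.stalk x)
  rw [ringKrullDim_stalk_eq_coheight] at hdim
  exact_mod_cast hdim

lemma coheight_genericPoint : Order.coheight (genericPoint C.X) = 0 :=
  Order.coheight_eq_zero.mpr fun y _ => C.le_genericPoint y

lemma eq_of_specializes {x y : C.X} (hx : x ≠ genericPoint C.X) (h : x ⤳ y) : y = x := by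
  by_contra hne
  have hyx : y < x := lt_of_le_not_ge h fun hc => hne (C.le_antisymm h hc)
  have hy : y ≠ genericPoint C.X := fun hc => hne (C.le_antisymm h (hc ▸ C.le_genericPoint x))
  have hcoh := Order.coheight_add_one_le hyx
  rw [C.coheight_eq_one hx, C.coheight_eq_one hy] at hcoh
  norm_num at hcoh

lemma isClosed_singleton {x : C.X} (hx : x ≠ genericPoint C.X) : IsClosed {x} :=
  isClosed_of_closure_subset fun _ hy =>
    C.eq_of_specializes hx (specializes_iff_mem_closure.mpr hy)

instance : CompactSpace C.X := (quasiCompact_iff_compactSpace C.hom).mp inferInstance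

instance : IsNoetherian C.X where

instance : C.X.IsSeparated := by
  have : IsSeparated (C.hom ≫ Limits.terminal.from _) := inferInstance
  rw [Limits.terminal.comp_from] at this
  exact ⟨this⟩

lemma finite_compl (U : C.X.Opens) (hU : genericPoint C.X ∈ U) : ((U : Set C.X)ᶜ).Finite := by
  obtain ⟨S, hSfin, hS, hirr, hUS⟩ :=
    TopologicalSpace.NoetherianSpace.exists_finite_set_isClosed_irreducible U.isOpen.isClosed_compl
  rw [hUS]
  refine Set.Finite.sUnion hSfin fun Z hZ => ?_
  have hgen := (hirr Z hZ).isGenericPoint_genericPoint (hS Z hZ)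
  have hne : (hirr Z hZ).genericPoint ≠ genericPoint C.X := fun hη =>
    (hUS ▸ Set.mem_sUnion_of_mem hgen.mem hZ : (hirr Z hZ).genericPoint ∈ (U : Set C.X)ᶜ)
      (hη.symm ▸ hU)
  exact (Set.finite_singleton _).subset fun y hy => C.eq_of_specializes hne (hgen.specializes hy)

/-- The inclusion of the constants into the local ring at a point. -/
noncomputable def toStalk (x : C.X) : k →+* C.X.presheaf.stalk x :=
  ((Scheme.ΓSpecIso (.of k)).inv ≫ C.hom.appTop ≫ C.X.presheaf.germ ⊤ x trivial).hom

noncomputable instance (x : C.X) : Algebra k (C.X.presheaf.stalk x) := (C.toStalk x).toAlgebra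

noncomputable instance (x : C.X) : Algebra k (C.X.residueField x) :=
  (C.toResidueField x).toAlgebra

instance (x : C.X) : IsScalarTower k (C.X.presheaf.stalk x) C.X.functionField :=
  have : Nonempty (⊤ : C.X.Opens) := ⟨⟨x, trivial⟩⟩
  .of_algebraMap_eq fun _ =>
    (Scheme.algebraMap_germ_eq_germToFunctionField C.X (U := ⊤) (x := x) trivial _).symm

/-- The closed points of the curve, encoded as the points other than the generic one. -/
abbrev ClosedPoint := {x : C.X // x ≠ genericPoint C.X}

noncomputable instance (x : C.ClosedPoint) : IsDiscreteValuationRing (C.X.presheaf.stalk x.1) :=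
  C.isDiscreteValuationRing_stalk x.2

/-- The valuation of the function field given by a closed point. -/
noncomputable def val (x : C.ClosedPoint) : Valuation C.X.functionField ℤᵐ⁰ :=
  (IsDiscreteValuationRing.maximalIdeal (C.X.presheaf.stalk x.1)).valuation C.X.functionField

variable {C} in
lemma exists_val_eq_exp_neg_one (x : C.ClosedPoint) : ∃ π, C.val x π = exp (-1) :=
  IsDedekindDomain.HeightOneSpectrum.valuation_exists_uniformizer _ _

lemma val_algebraMap_le_one (x : C.ClosedPoint) (a : C.X.presheaf.stalk x.1) :
    C.val x (algebraMap _ _ a) ≤ 1 :=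
  IsDedekindDomain.HeightOneSpectrum.valuation_le_one _ _

lemma exists_of_val_le_one {x : C.ClosedPoint} {f : C.X.functionField} (hf : C.val x f ≤ 1) :
    ∃ a : C.X.presheaf.stalk x.1, algebraMap _ _ a = f :=
  IsDiscreteValuationRing.exists_lift_of_le_one hf

lemma val_algebraMap_lt_one_iff (x : C.ClosedPoint) (a : C.X.presheaf.stalk x.1) :
    C.val x (algebraMap _ _ a) < 1 ↔ a ∈ maximalIdeal (C.X.presheaf.stalk x.1) :=
  IsDedekindDomain.HeightOneSpectrum.valuation_lt_one_iff_mem _ _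

instance (x : C.ClosedPoint) : (C.val x).IsTrivialOn k where
  eq_one c hc := by
    have hle (c : k) : C.val x (algebraMap k _ c) ≤ 1 := by
      rw [IsScalarTower.algebraMap_apply k (C.X.presheaf.stalk x.1)]
      exact C.val_algebraMap_le_one x _
    refine (hle c).antisymm ((inv_le_one₀ (by simpa [zero_lt_iff] using hc)).mp ?_)
    simpa using hle c⁻¹

lemma ord_eq_neg_log_val (x : C.ClosedPoint) (f : C.X.functionField) :
    C.X.ord f x.1 = - log (C.val x f) := by
  have hx := C.coheight_eq_one x.2
  rw [Scheme.ord_eq_ordHom_of_coheight_eq_one hx, ← log_inv]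
  have hord : C.X.ordHom x.1 hx f = (C.val x f)⁻¹ := Ring.ordFrac_eq_valuation_inv f
  rw [hord]
  cases (C.val x f)⁻¹ <;> rfl

lemma ord_genericPoint (f : C.X.functionField) : C.X.ord f (genericPoint C.X) = 0 := by
  refine Scheme.ord_eq_zero_of_coheight_neq_one ?_ f
  rw [C.coheight_genericPoint]
  exact zero_ne_one

lemma finite_toResidueField (x : C.ClosedPoint) : (C.toResidueField x.1).Finite := by
  have := isClosed_singleton_iff_isClosedImmersion.mp (C.isClosed_singleton x.2)
  have hfin : IsFinite (C.X.fromSpecResidueField x.1 ≫ C.hom) :=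
    isFinite_iff_locallyOfFiniteType_of_jacobsonSpace.mpr inferInstance
  have hhom : C.hom = C.X.toSpecΓ ≫ Spec.map ((Scheme.ΓSpecIso (.of k)).inv ≫ C.hom.appTop) := by
    rw [Spec.map_comp, ← Scheme.toSpecΓ_naturality_assoc, toSpecΓ_SpecMap_ΓSpecIso_inv,
      Category.comp_id]
  have heq : C.X.fromSpecResidueField x.1 ≫ C.hom =
      Spec.map (CommRingCat.ofHom (C.toResidueField x.1)) := by
    conv_lhs => rw [hhom]
    rw [Scheme.fromSpecResidueField, Category.assoc, Scheme.fromSpecStalk_toSpecΓ_assoc,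
      ← Spec.map_comp, ← Spec.map_comp]
    rfl
  rw [heq, IsFinite.SpecMap_iff] at hfin
  exact hfin

lemma relLength_valFilt_val (x : C.ClosedPoint) :
    relLength (valFilt k (C.val x) (-1)) (valFilt k (C.val x) 0) = C.pointDegree x.1 := by
  let φ : C.X.presheaf.stalk x.1 →ₗ[k] valFilt k (C.val x) 0 :=
    (IsScalarTower.toAlgHom k _ C.X.functionField).toLinearMap.codRestrict _
      fun a => C.val_algebraMap_le_one x a
  let ρ : C.X.presheaf.stalk x.1 →ₗ[k] C.X.residueField x.1 :=
    (AlgHom.mk (C.X.residue x.1).hom fun _ => rfl).toLinearMap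
  have hφ : Function.Surjective φ := fun f =>
    (C.exists_of_val_le_one (x := x) f.2).imp fun _ ha => Subtype.ext ha
  let q := ((valFilt k (C.val x) (-1)).submoduleOf (valFilt k (C.val x) 0)).mkQ
  have hker : LinearMap.ker (q ∘ₗ φ) = LinearMap.ker ρ := by
    ext a
    have hexp : (1 : ℤᵐ⁰) = exp (-1) * exp 1 := by simp
    change q (φ a) = 0 ↔ IsLocalRing.residue _ a = 0
    rw [Submodule.mkQ_apply, Submodule.Quotient.mk_eq_zero, IsLocalRing.residue_eq_zero_iff,
      ← C.val_algebraMap_lt_one_iff, hexp, lt_mul_exp_iff_le exp_ne_zero]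
    rfl
  let e := ((q ∘ₗ φ).quotKerEquivOfSurjective ((Submodule.mkQ_surjective _).comp hφ)).symm ≪≫ₗ
    Submodule.quotEquivOfEq _ _ hker ≪≫ₗ
      ρ.quotKerEquivOfSurjective IsLocalRing.residue_surjective
  have : Module.Finite k (C.X.residueField x.1) := C.finite_toResidueField x
  exact e.length_eq.trans (Module.length_eq_finrank k _)

lemma finite_val_ne_one {f : C.X.functionField} (hf : f ≠ 0) : {x | C.val x f ≠ 1}.Finite := by
  obtain ⟨U, -, f', hU, rfl, hf'⟩ := exists_isUnit_germ_eq C.X f hf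
  have hη : genericPoint C.X ∈ U :=
    ((genericPoint_spec C.X).mem_open_set_iff U.isOpen).mpr (by simpa using hU)
  refine Set.Finite.of_finite_image ((C.finite_compl U hη).subset ?_)
    Subtype.val_injective.injOn
  rintro _ ⟨x, hx, rfl⟩ hxU
  have hlog := Scheme.ord_of_isUnit hf' (x := x.1) hxU
  rw [C.ord_eq_neg_log_val, neg_eq_zero] at hlog
  apply hx
  rw [← exp_log ((C.val x).ne_zero_iff.mpr hf), hlog, exp_zero]

lemma pairwise_exists_val_le_one_lt :
    Pairwise fun x y : C.ClosedPoint => ∃ f, C.val x f ≤ 1 ∧ 1 < C.val y f := by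
  intro x y hxy
  by_contra! hle
  have hlt : ∀ f, C.val x f < 1 → C.val y f < 1 := by
    obtain ⟨π, hπ⟩ := exists_val_eq_exp_neg_one y
    have hπ_inv : 1 < C.val y π⁻¹ := by
      rw [map_inv₀, hπ, ← exp_neg, ← exp_zero, exp_lt_exp]
      norm_num
    exact fun f => lt_one_of_forall_le_one hle ⟨_, hπ_inv⟩
  choose ψ hψ using fun a => C.exists_of_val_le_one (hle _ (C.val_algebraMap_le_one x a))
  have hinj := IsFractionRing.injective (C.X.presheaf.stalk y.1) C.X.functionField
  let Ψ : C.X.presheaf.stalk x.1 →+* C.X.presheaf.stalk y.1 :=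
    { toFun := ψ
      map_one' := hinj (by rw [hψ, map_one, map_one])
      map_zero' := hinj (by rw [hψ, map_zero, map_zero])
      map_add' := fun a b => hinj (by rw [hψ, map_add, map_add, hψ, hψ])
      map_mul' := fun a b => hinj (by rw [hψ, map_mul, map_mul, hψ, hψ]) }
  have hloc : IsLocalHom Ψ := by
    refine ((local_hom_TFAE Ψ).out 0 3).mpr fun a ha => ?_
    rw [Ideal.mem_comap, ← C.val_algebraMap_lt_one_iff]
    exact (congr_arg (C.val y) (hψ a)).trans_lt (hlt _ ((C.val_algebraMap_lt_one_iff x a).mpr ha))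
  exact hxy (Subtype.ext (eq_of_isLocalHom_of_comp_algebraMap_eq Ψ (RingHom.ext hψ)))

lemma length_iInf_valFilt_ne_top :
    Module.length k (⨅ x, valFilt k (C.val x) 0 : Submodule k C.X.functionField) ≠ ⊤ := by
  let F := (Scheme.ΓSpecIso (.of k)).inv ≫ C.hom.appTop
  let : Algebra k Γ(C.X, ⊤) := F.hom.toAlgebra
  have : Module.Finite k Γ(C.X, ⊤) := (finite_appTop_of_universallyClosed k C.hom).comp
    (.of_surjective _ (ConcreteCategory.bijective_of_isIso (Scheme.ΓSpecIso (.of k)).inv).2)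
  let g : Γ(C.X, ⊤) →ₐ[k] C.X.functionField :=
    AlgHom.mk (C.X.presheaf.germ ⊤ (genericPoint C.X) trivial).hom fun _ => rfl
  have hle : (⨅ x, valFilt k (C.val x) 0) ≤ LinearMap.range g.toLinearMap := by
    intro f hf
    refine exists_germToFunctionField_eq fun x => ?_
    by_cases hx : x = genericPoint C.X
    · subst hx
      exact ⟨f, ConcreteCategory.congr_hom (C.X.presheaf.stalkSpecializes_refl _) f⟩
    · exact C.exists_of_val_le_one ((Submodule.mem_iInf _).mp hf ⟨x, hx⟩)
  exact ne_top_of_le_ne_top Module.length_ne_top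
    (Module.length_le_of_injective _ (Submodule.inclusion_injective hle))

lemma isProperPlaceFamily_val :
    IsProperPlaceFamily k C.val (fun x => C.pointDegree x.1) where
  uniformizer := exists_val_eq_exp_neg_one
  residue := C.relLength_valFilt_val
  finite _ := C.finite_val_ne_one
  incomparable := C.pairwise_exists_val_le_one_lt
  global := C.length_iInf_valFilt_ne_top

theorem finsum_ord_mul_pointDegree {f : C.X.functionField} (hf : f ≠ 0) :
    ∑ᶠ x : C.X, C.X.ord f x * (C.pointDegree x : ℤ) = 0 := by
  have hclosed : ∑ᶠ x : C.X, C.X.ord f x * (C.pointDegree x : ℤ) =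
      ∑ᶠ x : C.ClosedPoint, C.X.ord f x.1 * (C.pointDegree x.1 : ℤ) := by
    rw [finsum_subtype_eq_finsum_cond (f := fun x => C.X.ord f x * (C.pointDegree x : ℤ))]
    refine finsum_congr fun x => ?_
    by_cases hx : x = genericPoint C.X
    · simp [hx, C.ord_genericPoint]
    · simp [hx]
  rw [hclosed, ← neg_eq_zero, ← finsum_neg_distrib]
  refine (finsum_congr fun x => ?_).trans (C.isProperPlaceFamily_val.finsum_log_mul_eq_zero hf)
  rw [C.ord_eq_neg_log_val, neg_mul, neg_neg]

end SmoothProjectiveCurve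

section ModuleStalks

open TopologicalSpace Opposite Scheme.Modules

variable {X : Scheme.{u}}

noncomputable instance (M : X.Modules) (x : X) :
    Module (X.presheaf.stalk x) (M.presheaf.stalk x) :=
  PresheafOfModules.instModuleCarrierStalkCommRingCatCarrierAbPresheafOpensCarrier
    (R := X.presheaf) M.val x

/-- The germ at `x` of a section of a sheaf of modules. -/
noncomputable def sectionGerm (M : X.Modules) {U : X.Opens} {x : X} (hx : x ∈ U) :
    Γ(M, U) →+ M.presheaf.stalk x :=
  (TopCat.Presheaf.germ M.presheaf U x hx).hom

lemma sectionGerm_smul (M : X.Modules) {U : X.Opens} {x : X} (hx : x ∈ U) (r : Γ(X, U))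
    (s : Γ(M, U)) :
    sectionGerm M hx (r • s) = X.presheaf.germ U x hx r • sectionGerm M hx s :=
  PresheafOfModules.germ_smul (R := X.presheaf) M.val x U hx r s

lemma sectionGerm_sum_smul (M : X.Modules) {U : X.Opens} {x : X} (hx : x ∈ U) {ι : Type*}
    [Fintype ι] (r : ι → Γ(X, U)) (s : ι → Γ(M, U)) :
    sectionGerm M hx (∑ i, r i • s i) =
      ∑ i, X.presheaf.germ U x hx (r i) • sectionGerm M hx (s i) := by
  simp only [map_sum, sectionGerm_smul]

lemma sectionGerm_resSection (M : X.Modules) {U V : X.Opens} (h : V ≤ U) {x : X} (hx : x ∈ V)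
    (s : Γ(M, U)) : sectionGerm M hx (resSection M h s) = sectionGerm M (h hx) s :=
  TopCat.Presheaf.germ_res_apply M.presheaf (homOfLE h) x hx s

lemma resSection_resSection (M : X.Modules) {U V W : X.Opens} (h : V ≤ U) (h' : W ≤ V)
    (s : Γ(M, U)) : resSection M h' (resSection M h s) = resSection M (h'.trans h) s := by
  simp only [resSection, ← ConcreteCategory.comp_apply, ← Functor.map_comp]
  rfl

lemma resSection_sum_smul (M : X.Modules) {U V : X.Opens} (h : V ≤ U) {ι : Type*} [Fintype ι]
    (r : ι → Γ(X, U)) (s : ι → Γ(M, U)) :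
    resSection M h (∑ i, r i • s i) =
      ∑ i, X.presheaf.map (homOfLE h).op (r i) • resSection M h (s i) := by
  simp only [resSection, map_sum, map_smul]

lemma resSection_app {M N : X.Modules} (f : M ⟶ N) {U V : X.Opens} (h : V ≤ U) (s : Γ(M, U)) :
    resSection N h (f.app U s) = f.app V (resSection M h s) :=
  (ConcreteCategory.congr_hom (f.mapPresheaf.naturality (homOfLE h).op) s).symm

lemma exists_sectionGerm_eq (M : X.Modules) {U : X.Opens} {x : X} (hx : x ∈ U)
    (m : M.presheaf.stalk x) :
    ∃ (V : X.Opens) (_ : V ≤ U) (hV : x ∈ V) (s : Γ(M, V)), sectionGerm M hV s = m := by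
  obtain ⟨V, i, hV, s, rfl⟩ := TopCat.Presheaf.exists_le_germ_eq M.presheaf m hx
  exact ⟨V, i, hV, s, rfl⟩

lemma exists_resSection_eq (M : X.Modules) {U : X.Opens} {x : X} (hx : x ∈ U) {s t : Γ(M, U)}
    (h : sectionGerm M hx s = sectionGerm M hx t) :
    ∃ (V : X.Opens) (hVU : V ≤ U), x ∈ V ∧ resSection M hVU s = resSection M hVU t := by
  obtain ⟨V, hV, i, _, e⟩ := TopCat.Presheaf.germ_eq M.presheaf x hx hx s t h
  exact ⟨V, leOfHom i, hV, e⟩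

lemma section_ext (M : X.Modules) {U : X.Opens} {s t : Γ(M, U)}
    (h : ∀ x (hx : x ∈ U), sectionGerm M hx s = sectionGerm M hx t) : s = t :=
  TopCat.Presheaf.section_ext ⟨M.presheaf, M.isSheaf⟩ U s t h

/-- The map induced on stalks by a morphism of sheaves of modules, as a linear map over the local
ring. -/
noncomputable def stalkLinearMap {M N : X.Modules} (f : M ⟶ N) (x : X) :
    M.presheaf.stalk x →ₗ[X.presheaf.stalk x] N.presheaf.stalk x where
  toFun := (TopCat.Presheaf.stalkFunctor Ab x).map f.mapPresheaf
  map_add' := map_add _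
  map_smul' r m := by
    obtain ⟨U, hU, a, rfl⟩ := X.presheaf.exists_germ_eq r
    obtain ⟨V, hVU, hV, s, rfl⟩ := exists_sectionGerm_eq M hU m
    have map_germ (t : Γ(M, V)) : (TopCat.Presheaf.stalkFunctor Ab x).map f.mapPresheaf
        (sectionGerm M hV t) = sectionGerm N hV (f.app V t) :=
      TopCat.Presheaf.stalkFunctor_map_germ_apply V x hV f.mapPresheaf t
    rw [← X.presheaf.germ_res_apply (homOfLE hVU) x hV a, ← sectionGerm_smul, map_germ, map_germ,
      f.app_smul, sectionGerm_smul]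
    rfl

lemma stalkLinearMap_sectionGerm {M N : X.Modules} (f : M ⟶ N) {U : X.Opens} {x : X}
    (hx : x ∈ U) (s : Γ(M, U)) :
    stalkLinearMap f x (sectionGerm M hx s) = sectionGerm N hx (f.app U s) :=
  TopCat.Presheaf.stalkFunctor_map_germ_apply U x hx f.mapPresheaf s

lemma stalkLinearMap_comp {M N P : X.Modules} (f : M ⟶ N) (g : N ⟶ P) (x : X) :
    stalkLinearMap (f ≫ g) x = stalkLinearMap g x ∘ₗ stalkLinearMap f x := by
  ext m
  obtain ⟨U, -, hU, s, rfl⟩ := exists_sectionGerm_eq M (U := ⊤) trivial m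
  rw [LinearMap.comp_apply, stalkLinearMap_sectionGerm, stalkLinearMap_sectionGerm,
    stalkLinearMap_sectionGerm, Hom.comp_app, ConcreteCategory.comp_apply]

lemma stalkLinearMap_zero {M N : X.Modules} (x : X) : stalkLinearMap (0 : M ⟶ N) x = 0 := by
  ext m
  obtain ⟨U, -, hU, s, rfl⟩ := exists_sectionGerm_eq M (U := ⊤) trivial m
  exact (stalkLinearMap_sectionGerm _ hU s).trans (map_zero _)

/-- Sections over `U`, as a module over the sections of the structure sheaf. -/
noncomputable def sectionsFunctor (U : X.Opens) : X.Modules ⥤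
    ModuleCat (X.ringCatSheaf.obj.obj (op U)) :=
  toPresheafOfModules X ⋙ PresheafOfModules.evaluation X.ringCatSheaf.obj (op U)

instance (U : X.Opens) : Limits.PreservesLimits (sectionsFunctor U) :=
  Limits.comp_preservesLimits _ _

instance (U : X.Opens) : (sectionsFunctor U).PreservesZeroMorphisms where
  map_zero _ _ := rfl

instance : (toPresheafOfModules X).PreservesZeroMorphisms where
  map_zero _ _ := rfl

lemma app_injective {M N : X.Modules} (f : M ⟶ N) [Mono f] (U : X.Opens) :
    Function.Injective (f.app U) :=
  (ModuleCat.mono_iff_injective ((sectionsFunctor U).map f)).mp inferInstance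

lemma stalkLinearMap_injective {M N : X.Modules} (f : M ⟶ N) [Mono f] (x : X) :
    Function.Injective (stalkLinearMap f x) :=
  TopCat.Presheaf.stalkFunctor_map_injective_of_app_injective (f := f.mapPresheaf)
    (fun U => app_injective f U) x

lemma mono_of_stalkLinearMap_injective {M N : X.Modules} (f : M ⟶ N)
    (h : ∀ x, Function.Injective (stalkLinearMap f x)) : Mono f := by
  refine (toPresheaf X).mono_of_mono_map ?_
  have (U : (Opens X)ᵒᵖ) : Mono (((toPresheaf X).map f).app U) := by
    refine (AddCommGrpCat.mono_iff_injective _).mpr fun s t hst => section_ext M fun x hx => h x ?_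
    exact (stalkLinearMap_sectionGerm f hx s).trans
      ((congrArg _ hst).trans (stalkLinearMap_sectionGerm f hx t).symm)
  exact NatTrans.mono_of_mono_app _

lemma exists_app_eq_of_exact {S : ShortComplex X.Modules} (hS : S.Exact) [Mono S.f] (U : X.Opens)
    (s : Γ(S.X₂, U)) (h : S.g.app U s = 0) : ∃ t : Γ(S.X₁, U), S.f.app U t = s :=
  (ShortComplex.moduleCat_exact_iff _).mp
    (hS.map_of_mono_of_preservesKernel (sectionsFunctor U) inferInstance inferInstance) s h

lemma ker_stalkLinearMap_le_range {S : ShortComplex X.Modules} (hS : S.Exact) [Mono S.f] (x : X) :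
    LinearMap.ker (stalkLinearMap S.g x) ≤ LinearMap.range (stalkLinearMap S.f x) := by
  intro m hm
  obtain ⟨U, -, hU, s, rfl⟩ := exists_sectionGerm_eq S.X₂ (U := ⊤) trivial m
  rw [LinearMap.mem_ker, stalkLinearMap_sectionGerm] at hm
  obtain ⟨V, hVU, hV, hres⟩ := exists_resSection_eq S.X₃ hU (hm.trans (map_zero _).symm)
  obtain ⟨t, ht⟩ := exists_app_eq_of_exact hS V (resSection S.X₂ hVU s) <| by
    rw [← resSection_app, hres]
    exact map_zero _
  exact ⟨sectionGerm S.X₁ hV t, by rw [stalkLinearMap_sectionGerm, ht, sectionGerm_resSection]⟩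

lemma exact_stalkLinearMap {S : ShortComplex X.Modules} (hS : S.Exact) [Mono S.f] (x : X) :
    Function.Exact (stalkLinearMap S.f x) (stalkLinearMap S.g x) := by
  refine LinearMap.exact_of_comp_of_mem_range ?_ fun m hm => ker_stalkLinearMap_le_range hS x hm
  rw [← stalkLinearMap_comp, S.zero, stalkLinearMap_zero]

lemma cokernel_π_comp_unit_eq_zero {M N : X.Modules} (f : M ⟶ N) [Epi f] :
    Limits.cokernel.π ((toPresheafOfModules X).map f) ≫
      (PresheafOfModules.sheafificationAdjunction (𝟙 X.ringCatSheaf.obj)).unit.app _ = 0 := by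
  let Q := Limits.cokernel ((toPresheafOfModules X).map f)
  let A : X.Modules := (PresheafOfModules.sheafification (𝟙 X.ringCatSheaf.obj)).obj Q
  obtain ⟨g, hg⟩ := (toPresheafOfModules X).map_surjective (X := N) (Y := A)
    (Limits.cokernel.π ((toPresheafOfModules X).map f) ≫
      (PresheafOfModules.sheafificationAdjunction (𝟙 X.ringCatSheaf.obj)).unit.app Q)
  have hfg : f ≫ g = 0 := by
    apply (toPresheafOfModules X).map_injective
    rw [Functor.map_comp, hg, Functor.map_zero]
    exact (Limits.cokernel.condition_assoc _ _).trans Limits.zero_comp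
  have hg0 : g = 0 := (cancel_epi f).mp (hfg.trans Limits.comp_zero.symm)
  exact hg.symm.trans (by rw [hg0, Functor.map_zero]; rfl)

/-- The presheaf cokernel of an epimorphism dies in its sheafification, so each of its sections
vanishes locally. -/
lemma isLocallySurjective_mapPresheaf {M N : X.Modules} (f : M ⟶ N) [Epi f] :
    TopCat.Presheaf.IsLocallySurjective f.mapPresheaf := by
  let F := (toPresheafOfModules X).map f
  let q := Limits.cokernel.π F
  let η := toSheafify (Opens.grothendieckTopology X) (Limits.cokernel F).presheaf
  refine (TopCat.Presheaf.isLocallySurjective_iff _).mpr fun U s x hx => ?_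
  have hs : η.app (op U) (q.app (op U) s) = η.app (op U) 0 := by
    rw [map_zero]
    exact congrArg (fun φ => PresheafOfModules.Hom.app φ (op U) s) (cokernel_π_comp_unit_eq_zero f)
  obtain ⟨V, i, hi, hV⟩ :=
    Presheaf.equalizerSieve_mem (Opens.grothendieckTopology X) η _ _ hs x hx
  have hqs : q.app (op V) (resSection N i.le s) = 0 :=
    (PresheafOfModules.naturality_apply q i.op s).trans (hi.trans (map_zero _))
  have hexact := (ShortComplex.exact_cokernel F).map_of_epi_of_preservesCokernel
    (PresheafOfModules.evaluation _ (op V)) inferInstance inferInstance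
  obtain ⟨t, ht⟩ := (ShortComplex.moduleCat_exact_iff _).mp hexact _ hqs
  exact ⟨V, i.le, ⟨t, ht⟩, hV⟩

lemma stalkLinearMap_surjective {M N : X.Modules} (f : M ⟶ N) [Epi f] (x : X) :
    Function.Surjective (stalkLinearMap f x) :=
  (TopCat.Presheaf.locally_surjective_iff_surjective_on_stalks f.mapPresheaf).mp
    (isLocallySurjective_mapPresheaf f) x

end ModuleStalks

section SemilinearAlgebra

variable {R S M N ι : Type*} [CommRing R] [CommRing S] [AddCommGroup M] [AddCommGroup N]
  [Module R M] [Module S N]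

lemma map_basis_det_of_semilinear [Fintype ι] [DecidableEq ι] (φ : R →+* S) (f : M →+ N)
    (hf : ∀ r m, f (r • m) = φ r • f m) (b : Module.Basis ι R M) (b' : Module.Basis ι S N)
    (hb : ∀ i, b' i = f (b i)) (v : ι → M) : φ (b.det v) = b'.det (f ∘ v) := by
  have expand (j : ι) : f (v j) = ∑ i, φ (b.repr (v j) i) • b' i := by
    conv_lhs => rw [← b.sum_repr (v j)]
    simp only [map_sum, hf, hb]
  rw [Module.Basis.det_apply, Module.Basis.det_apply, RingHom.map_det]
  congr 1
  ext i j
  rw [RingHom.mapMatrix_apply, Matrix.map_apply, Module.Basis.toMatrix_apply,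
    Module.Basis.toMatrix_apply, Function.comp_apply, expand, b'.repr_sum_self]

lemma linearIndependent_comp_iff_of_isFractionRing {K V : Type*} [Field K]
    [Algebra R K] [IsFractionRing R K] [AddCommGroup V] [Module K V]
    (f : M →+ V) (hf : ∀ r m, f (r • m) = algebraMap R K r • f m) (hinj : Function.Injective f)
    (v : ι → M) : LinearIndependent K (f ∘ v) ↔ LinearIndependent R v := by
  let : Module R V := Module.compHom V (algebraMap R K)
  have : IsScalarTower R K V := ⟨fun r a w => by
    rw [Algebra.smul_def, mul_smul]; rfl⟩
  rw [← LinearIndependent.iff_fractionRing R K]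
  let f' : M →ₗ[R] V := { f with map_smul' := hf }
  exact LinearMap.linearIndependent_iff_of_injOn f' hinj.injOn

lemma injective_of_linearIndependent_basis (φ : R →+* S) (hφ : Function.Injective φ) (f : M →+ N)
    (hf : ∀ r m, f (r • m) = φ r • f m) (b : Module.Basis ι R M)
    (hb : LinearIndependent S (f ∘ b)) : Function.Injective f := by
  rw [injective_iff_map_eq_zero]
  intro m hm
  have expand : ∑ i ∈ (b.repr m).support, φ (b.repr m i) • (f ∘ b) i = 0 := by
    rw [← hm]
    conv_rhs => rw [← b.linearCombination_repr m, Finsupp.linearCombination_apply, Finsupp.sum]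
    simp only [map_sum, hf, Function.comp_apply]
  rw [← b.repr.map_eq_zero_iff]
  ext i
  by_contra hi
  exact hi (hφ ((linearIndependent_iff'.mp hb _ _ expand i (Finsupp.mem_support_iff.mpr hi)).trans
    (map_zero φ).symm))

end SemilinearAlgebra

lemma exists_common_germ_eq {X : TopCat.{u}} {C : Type*} [Category.{u} C]
    [Limits.HasColimits C] {FC : C → C → Type*} {CC : C → Type u}
    [∀ X Y, FunLike (FC X Y) (CC X) (CC Y)] [ConcreteCategory C FC]
    [Limits.PreservesFilteredColimits (CategoryTheory.forget C)] (F : X.Presheaf C) {x : X}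
    {U : TopologicalSpace.Opens X} (hx : x ∈ U) {ι : Type*} [Finite ι]
    (t : ι → ToType (F.stalk x)) :
    ∃ (V : TopologicalSpace.Opens X) (_ : V ≤ U) (hV : x ∈ V)
      (s : ι → ToType (F.obj (.op V))), ∀ i, F.germ V x hV (s i) = t i := by
  have := Fintype.ofFinite ι
  choose V _ hV s hs using fun i => F.exists_le_germ_eq (t i) hx
  have hmem : x ∈ U ⊓ Finset.univ.inf V := by
    refine ⟨hx, ?_⟩
    rw [SetLike.mem_coe, ← SetLike.mem_coe, TopologicalSpace.Opens.coe_finset_inf]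
    simpa using hV
  have hle (i) : U ⊓ Finset.univ.inf V ≤ V i :=
    inf_le_right.trans (Finset.inf_le (Finset.mem_univ i))
  refine ⟨_, inf_le_left, hmem, fun i => F.map (homOfLE (hle i)).op (s i), fun i => ?_⟩
  rw [TopCat.Presheaf.germ_res_apply, hs]

section SectionsAndGerms

variable {X : Scheme.{u}} {M : X.Modules} {U : X.Opens} {ι : Type*} {s : ι → Γ(M, U)}

lemma linearIndependent_sectionGerm [Finite ι]
    (hs : ∀ (V : X.Opens) (h : V ≤ U), LinearIndependent Γ(X, V) (fun i => resSection M h (s i)))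
    {x : X} (hx : x ∈ U) :
    LinearIndependent (X.presheaf.stalk x) (fun i => sectionGerm M hx (s i)) := by
  have := Fintype.ofFinite ι
  rw [Fintype.linearIndependent_iff]
  intro g hg i
  obtain ⟨V, hVU, hV, r, hr⟩ := exists_common_germ_eq X.presheaf hx g
  have germ_eq_zero :
      sectionGerm M hV (∑ i, r i • resSection M hVU (s i)) = sectionGerm M hV 0 := by
    simp only [sectionGerm_sum_smul, sectionGerm_resSection, hr, hg, map_zero]
  obtain ⟨W, hWV, hW, res_eq_zero⟩ := exists_resSection_eq M hV germ_eq_zero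
  simp only [resSection_sum_smul, resSection_resSection] at res_eq_zero
  have coeff_eq_zero := Fintype.linearIndependent_iff.mp (hs W (hWV.trans hVU)) _
    (res_eq_zero.trans (map_zero (M.presheaf.map (homOfLE hWV).op).hom)) i
  rw [← hr, ← X.presheaf.germ_res_apply (homOfLE hWV) x hW, coeff_eq_zero, map_zero]

lemma linearIndependent_resSection [Finite ι]
    (hs : ∀ x (hx : x ∈ U),
      LinearIndependent (X.presheaf.stalk x) (fun i => sectionGerm M hx (s i)))
    {V : X.Opens} (h : V ≤ U) : LinearIndependent Γ(X, V) (fun i => resSection M h (s i)) := by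
  have := Fintype.ofFinite ι
  rw [Fintype.linearIndependent_iff]
  intro g hg i
  refine TopCat.Presheaf.section_ext X.sheaf V _ _ fun x hx => ?_
  have germ_eq_zero : ∑ i, X.presheaf.germ V x hx (g i) • sectionGerm M (h hx) (s i) = 0 := by
    simp only [← sectionGerm_resSection M h hx, ← sectionGerm_sum_smul, hg, map_zero]
  exact (Fintype.linearIndependent_iff.mp (hs x (h hx)) _ germ_eq_zero i).trans
    (map_zero _).symm

variable [Fintype ι]

lemma exists_sum_smul_eq_resSection {V : X.Opens} (h : V ≤ U) (m : Γ(M, V)) {x : X} (hx : x ∈ V)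
    (hm : sectionGerm M hx m ∈
      Submodule.span (X.presheaf.stalk x) (Set.range fun i => sectionGerm M (h hx) (s i))) :
    ∃ (W : X.Opens) (hWV : W ≤ V) (_ : x ∈ W) (r : ι → Γ(X, W)),
      ∑ i, r i • resSection M (hWV.trans h) (s i) = resSection M hWV m := by
  obtain ⟨c, hc⟩ := (Submodule.mem_span_range_iff_exists_fun _).mp hm
  obtain ⟨W, hWV, hW, r, hr⟩ := exists_common_germ_eq X.presheaf hx c
  have germ_eq : sectionGerm M hW (∑ i, r i • resSection M (hWV.trans h) (s i)) =
      sectionGerm M hW (resSection M hWV m) := by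
    simp only [sectionGerm_sum_smul, sectionGerm_resSection, hr, hc]
  obtain ⟨W', hW', hxW', res_eq⟩ := exists_resSection_eq M hW germ_eq
  refine ⟨W', hW'.trans hWV, hxW', fun i => X.presheaf.map (homOfLE hW').op (r i), ?_⟩
  simpa only [resSection_sum_smul, resSection_resSection] using res_eq

lemma exists_sum_smul_eq_of_locally
    (hs : ∀ (V : X.Opens) (h : V ≤ U), LinearIndependent Γ(X, V) (fun i => resSection M h (s i)))
    {V : X.Opens} (h : V ≤ U) (m : Γ(M, V))
    (hm : ∀ x : V, ∃ (W : X.Opens) (hWV : W ≤ V) (_ : x.1 ∈ W) (r : ι → Γ(X, W)),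
      ∑ i, r i • resSection M (hWV.trans h) (s i) = resSection M hWV m) :
    ∃ a : ι → Γ(X, V), ∑ i, a i • resSection M h (s i) = m := by
  choose W hWV hW r hr using hm
  have restrict (z : V) {W' : X.Opens} (h' : W' ≤ W z) :
      ∑ i, X.presheaf.map (homOfLE h').op (r z i) • resSection M (h'.trans (hWV z) |>.trans h)
        (s i) = resSection M (h'.trans (hWV z)) m := by
    simpa only [resSection_sum_smul, resSection_resSection] using congrArg (resSection M h') (hr z)
  have compatible (i : ι) (x y : V) :
      X.presheaf.map (homOfLE (inf_le_left : W x ⊓ W y ≤ W x)).op (r x i) =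
        X.presheaf.map (homOfLE (inf_le_right : W x ⊓ W y ≤ W y)).op (r y i) := by
    refine sub_eq_zero.mp <| Fintype.linearIndependent_iff.mp
      (hs (W x ⊓ W y) (inf_le_left.trans (hWV x) |>.trans h)) (fun i =>
        X.presheaf.map (homOfLE inf_le_left).op (r x i) -
          X.presheaf.map (homOfLE inf_le_right).op (r y i)) ?_ i
    simp only [sub_smul, Finset.sum_sub_distrib]
    exact sub_eq_zero.mpr ((restrict x inf_le_left).trans (restrict y inf_le_right).symm)
  have glue (i : ι) : ∃ a : Γ(X, V), ∀ x, X.presheaf.map (homOfLE (hWV x)).op a = r x i :=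
    (X.sheaf.existsUnique_gluing' W V (fun x => homOfLE (hWV x))
      (fun x hx => TopologicalSpace.Opens.mem_iSup.mpr ⟨⟨x, hx⟩, hW _⟩) (fun x => r x i)
      (compatible i)).exists
  choose a ha using glue
  refine ⟨a, section_ext M fun x hx => ?_⟩
  rw [← sectionGerm_resSection M (hWV ⟨x, hx⟩) (hW _) m, ← hr]
  simp only [sectionGerm_sum_smul, sectionGerm_resSection, ← ha, TopCat.Presheaf.germ_res_apply]

end SectionsAndGerms

lemma isFrame_of_sectionGerm {X : Scheme.{u}} {M : X.Modules} {n : ℕ} {U : X.Opens}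
    {s : Fin n → Γ(M, U)}
    (hli : ∀ x (hx : x ∈ U),
      LinearIndependent (X.presheaf.stalk x) (fun i => sectionGerm M hx (s i)))
    (hsp : ∀ x (hx : x ∈ U),
      Submodule.span (X.presheaf.stalk x) (Set.range fun i => sectionGerm M hx (s i)) = ⊤) :
    IsFrame M U s where
  linearIndependent _ h := linearIndependent_resSection hli h
  span_eq_top V h := by
    refine eq_top_iff.mpr fun m _ => (Submodule.mem_span_range_iff_exists_fun _).mpr ?_
    refine exists_sum_smul_eq_of_locally (fun V h => linearIndependent_resSection hli h) h m ?_
    exact fun x => exists_sum_smul_eq_resSection h m x.2 (hsp x.1 (h x.2) ▸ Submodule.mem_top)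

namespace IsFrame

variable {X : Scheme.{u}} {M : X.Modules} {n : ℕ} {U : X.Opens} {s : Fin n → Γ(M, U)}

lemma basis_apply (hs : IsFrame M U s) {V : X.Opens} (h : V ≤ U) (i : Fin n) :
    hs.basis h i = resSection M h (s i) :=
  Module.Basis.mk_apply _ _ i

lemma span_sectionGerm_eq_top (hs : IsFrame M U s) {x : X} (hx : x ∈ U) :
    Submodule.span (X.presheaf.stalk x) (Set.range fun i => sectionGerm M hx (s i)) = ⊤ := by
  refine eq_top_iff.mpr fun m _ => ?_
  obtain ⟨V, hVU, hV, t, rfl⟩ := exists_sectionGerm_eq M hx m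
  rw [← (hs.basis hVU).sum_repr t, sectionGerm_sum_smul]
  refine Submodule.sum_mem _ fun i _ => Submodule.smul_mem _ _ (Submodule.subset_span ⟨i, ?_⟩)
  rw [hs.basis_apply, sectionGerm_resSection]

/-- The basis of the stalk given by the germs of a frame. -/
noncomputable def stalkBasis (hs : IsFrame M U s) {x : X} (hx : x ∈ U) :
    Module.Basis (Fin n) (X.presheaf.stalk x) (M.presheaf.stalk x) :=
  Module.Basis.mk (linearIndependent_sectionGerm hs.linearIndependent hx)
    (hs.span_sectionGerm_eq_top hx).ge

lemma stalkBasis_apply (hs : IsFrame M U s) {x : X} (hx : x ∈ U) (i : Fin n) :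
    hs.stalkBasis hx i = sectionGerm M hx (s i) :=
  Module.Basis.mk_apply _ _ i

lemma germ_basis_det (hs : IsFrame M U s) {V : X.Opens} (h : V ≤ U) {x : X} (hx : x ∈ V)
    (v : Fin n → Γ(M, V)) :
    X.presheaf.germ V x hx ((hs.basis h).det v) =
      (hs.stalkBasis (h hx)).det (fun i => sectionGerm M hx (v i)) := by
  refine map_basis_det_of_semilinear (X.presheaf.germ V x hx).hom (sectionGerm M hx)
    (sectionGerm_smul M hx) _ _ (fun i => ?_) v
  rw [hs.basis_apply, hs.stalkBasis_apply, sectionGerm_resSection]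

lemma exists_spread_basis (hs : IsFrame M U s) {x : X} (hx : x ∈ U) {ι : Type*} [Finite ι]
    (b : Module.Basis ι (X.presheaf.stalk x) (M.presheaf.stalk x)) :
    ∃ (W : X.Opens) (hW : x ∈ W) (t : ι → Γ(M, W)), (∀ i, sectionGerm M hW (t i) = b i) ∧
      ∀ y (hy : y ∈ W), LinearIndependent (X.presheaf.stalk y) (fun i => sectionGerm M hy (t i)) ∧
        Submodule.span (X.presheaf.stalk y) (Set.range fun i => sectionGerm M hy (t i)) = ⊤ := by
  let e : ι ≃ Fin n := b.indexEquiv (hs.stalkBasis hx)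
  obtain ⟨V, hVU, hV, t, ht⟩ := exists_common_germ_eq M.presheaf hx b
  let d : Γ(X, V) := (hs.basis hVU).det (t ∘ e.symm)
  have hle : X.basicOpen d ≤ V := X.basicOpen_le d
  have hd : x ∈ X.basicOpen d := by
    rw [X.mem_basicOpen d x hV, hs.germ_basis_det]
    convert! (hs.stalkBasis hx).isUnit_det (b.reindex e) using 2
    ext i
    rw [Module.Basis.reindex_apply]
    exact ht _
  refine ⟨X.basicOpen d, hd, fun i => resSection M hle (t i), fun i => ?_, fun y hy => ?_⟩
  · rw [sectionGerm_resSection]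
    exact ht i
  · have isUnit_det := (X.mem_basicOpen d y (hle hy)).mp hy
    rw [hs.germ_basis_det, ← Module.Basis.is_basis_iff_det] at isUnit_det
    simp only [sectionGerm_resSection]
    refine ⟨(linearIndependent_equiv e.symm).mp isUnit_det.1, ?_⟩
    rw [← isUnit_det.2, ← e.symm.surjective.range_comp]
    rfl

end IsFrame

section GenericStalk

lemma genericPoint_mem {X : Scheme.{u}} [IrreducibleSpace X] {U : X.Opens} {x : X} (hx : x ∈ U) :
    genericPoint X ∈ U :=
  ((genericPoint_spec X).mem_open_set_iff U.isOpen).mpr ⟨x, Set.mem_univ _, hx⟩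

/-- The specialization map from the stalk at `x` to the generic stalk. -/
noncomputable def toGenericStalk {X : Scheme.{u}} [IrreducibleSpace X] (M : X.Modules) (x : X) :
    M.presheaf.stalk x →+ M.presheaf.stalk (genericPoint X) :=
  (TopCat.Presheaf.stalkSpecializes M.presheaf ((genericPoint_spec X).specializes trivial)).hom

lemma toGenericStalk_sectionGerm {X : Scheme.{u}} [IrreducibleSpace X] (M : X.Modules)
    {U : X.Opens} {x : X} (hx : x ∈ U) (s : Γ(M, U)) :
    toGenericStalk M x (sectionGerm M hx s) = sectionGerm M (genericPoint_mem hx) s :=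
  ConcreteCategory.congr_hom (TopCat.Presheaf.germ_stalkSpecializes M.presheaf hx
    ((genericPoint_spec X).specializes trivial)) s

lemma toGenericStalk_smul {X : Scheme.{u}} [IsIntegral X] (M : X.Modules) (x : X)
    (r : X.presheaf.stalk x) (m : M.presheaf.stalk x) :
    toGenericStalk M x (r • m) =
      algebraMap (X.presheaf.stalk x) X.functionField r • toGenericStalk M x m := by
  obtain ⟨U, hU, a, rfl⟩ := X.presheaf.exists_germ_eq r
  obtain ⟨V, hVU, hV, s, rfl⟩ := exists_sectionGerm_eq M hU m
  have : Nonempty V := ⟨⟨x, hV⟩⟩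
  rw [← X.presheaf.germ_res_apply (homOfLE hVU) x hV a, ← sectionGerm_smul,
    toGenericStalk_sectionGerm, sectionGerm_smul, toGenericStalk_sectionGerm,
    Scheme.algebraMap_germ_eq_germToFunctionField]

lemma stalkLinearMap_toGenericStalk {X : Scheme.{u}} [IrreducibleSpace X] {M N : X.Modules}
    (f : M ⟶ N) (x : X) (m : M.presheaf.stalk x) :
    stalkLinearMap f (genericPoint X) (toGenericStalk M x m) =
      toGenericStalk N x (stalkLinearMap f x m) := by
  obtain ⟨U, -, hU, s, rfl⟩ := exists_sectionGerm_eq M (U := ⊤) trivial m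
  simp only [toGenericStalk_sectionGerm, stalkLinearMap_sectionGerm]

end GenericStalk

namespace CurveBundle

variable {k : Type u} [Field k] {C : SmoothProjectiveCurve k}

/-- The basis of the stalk at `x` given by the frame chosen near `x`. -/
noncomputable def stalkBasis (E : CurveBundle C) (x : C.X) :
    Module.Basis (Fin E.rank) (C.X.presheaf.stalk x) (E.sheaf.presheaf.stalk x) :=
  (E.isFrame_frame x).stalkBasis (E.mem_nhd x)

/-- The basis of the generic stalk given by the frame chosen near `x`. -/
noncomputable def genericBasis (E : CurveBundle C) (x : C.X) :
    Module.Basis (Fin E.rank) C.X.functionField (E.sheaf.presheaf.stalk (genericPoint C.X)) :=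
  (E.isFrame_frame x).stalkBasis (genericPoint_mem (E.mem_nhd x))

lemma genericBasis_apply (E : CurveBundle C) (x : C.X) (i : Fin E.rank) :
    E.genericBasis x i = toGenericStalk E.sheaf x (E.stalkBasis x i) := by
  rw [stalkBasis, genericBasis, IsFrame.stalkBasis_apply, IsFrame.stalkBasis_apply,
    toGenericStalk_sectionGerm]

lemma toGenericStalk_injective (E : CurveBundle C) (x : C.X) :
    Function.Injective (toGenericStalk E.sheaf x) := by
  refine injective_of_linearIndependent_basis (algebraMap (C.X.presheaf.stalk x) C.X.functionField)
    (IsFractionRing.injective _ _) _ (toGenericStalk_smul _ _) (E.stalkBasis x) ?_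
  convert! (E.genericBasis x).linearIndependent using 1
  ext i
  exact (E.genericBasis_apply x i).symm

lemma linearIndependent_toGenericStalk_iff (E : CurveBundle C) (x : C.X) {ι : Type*}
    (v : ι → E.sheaf.presheaf.stalk x) :
    LinearIndependent C.X.functionField (toGenericStalk E.sheaf x ∘ v) ↔
      LinearIndependent (C.X.presheaf.stalk x) v :=
  linearIndependent_comp_iff_of_isFractionRing _ (toGenericStalk_smul _ _)
    (E.toGenericStalk_injective x) v

lemma finrank_genericStalk (E : CurveBundle C) :
    Module.finrank C.X.functionField (E.sheaf.presheaf.stalk (genericPoint C.X)) = E.rank := by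
  rw [Module.finrank_eq_card_basis (E.genericBasis (genericPoint C.X)), Fintype.card_fin]

instance (E : CurveBundle C) :
    Module.Finite C.X.functionField (E.sheaf.presheaf.stalk (genericPoint C.X)) :=
  .of_basis (E.genericBasis (genericPoint C.X))

/-- A locally free sheaf as a vector bundle. The local ranks agree, being the dimension of the
generic stalk. -/
noncomputable def ofExistsFrame (M : C.X.Modules) (h : ∀ x : C.X, ∃ U : C.X.Opens, x ∈ U ∧
    ∃ (n : ℕ) (s : Fin n → Γ(M, U)), IsFrame M U s) : CurveBundle C where
  sheaf := M
  rank := Module.finrank C.X.functionField (M.presheaf.stalk (genericPoint C.X))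
  exists_frame x := by
    obtain ⟨U, hx, n, s, hs⟩ := h x
    have : Module.finrank C.X.functionField (M.presheaf.stalk (genericPoint C.X)) = n := by
      rw [Module.finrank_eq_card_basis (R := C.X.functionField)
        (hs.stalkBasis (genericPoint_mem hx)), Fintype.card_fin]
    rw [this]
    exact ⟨U, hx, s, hs⟩

end CurveBundle

section ExactSequences

variable {R α β : Type*} [Ring R]

section Basis

universe v

variable {A B D : Type v} [AddCommGroup A] [AddCommGroup B] [AddCommGroup D]
  [Module R A] [Module R B] [Module R D] {i : A →ₗ[R] B} {p : B →ₗ[R] D}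

/-- The basis of the middle term of an exact sequence `0 → A → B → D` consisting of the image of a
basis of `A` and a lift of a basis of `D`. -/
noncomputable def exactBasis (hi : Function.Injective i) (hip : Function.Exact i p)
    (bA : Module.Basis α R A) (bD : Module.Basis β R D) {l : β → B} (hl : ∀ t, p (l t) = bD t) :
    Module.Basis (α ⊕ β) R B :=
  let S : ShortComplex (ModuleCat R) :=
    .mk (ModuleCat.ofHom i) (ModuleCat.ofHom p) (ModuleCat.hom_ext hip.linearMap_comp_eq_zero)
  have hS : S.Exact := (ShortComplex.ShortExact.moduleCat_exact_iff_function_exact S).mpr hip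
  have hl' : p ∘ Sum.elim (i ∘ bA) l ∘ Sum.inr = bD := funext hl
  Module.Basis.mk (v := Sum.elim (i ∘ bA) l)
    (ModuleCat.linearIndependent_leftExact hS bA.linearIndependent
      (hl' ▸ bD.linearIndependent)
      ((ModuleCat.mono_iff_injective _).mpr hi) rfl)
    (ModuleCat.span_exact hS rfl bA.span_eq.ge (hl' ▸ bD.span_eq.ge))

lemma exactBasis_inl (hi : Function.Injective i) (hip : Function.Exact i p)
    (bA : Module.Basis α R A) (bD : Module.Basis β R D) {l : β → B} (hl : ∀ t, p (l t) = bD t)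
    (s : α) : exactBasis hi hip bA bD hl (.inl s) = i (bA s) := by
  rw [exactBasis, Module.Basis.mk_apply, Sum.elim_inl, Function.comp_apply]

lemma exactBasis_inr (hi : Function.Injective i) (hip : Function.Exact i p)
    (bA : Module.Basis α R A) (bD : Module.Basis β R D) {l : β → B} (hl : ∀ t, p (l t) = bD t)
    (t : β) : exactBasis hi hip bA bD hl (.inr t) = l t := by
  rw [exactBasis, Module.Basis.mk_apply, Sum.elim_inr]

end Basis

variable {A B D : Type*} [AddCommGroup A] [AddCommGroup B] [AddCommGroup D]
  [Module R A] [Module R B] [Module R D] {i : A →ₗ[R] B} {p : B →ₗ[R] D}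
  {g : α ⊕ β → B} {a : α → A}

lemma linearIndependent_of_map_eq_inl (hg : LinearIndependent R g)
    (ha : ∀ s, i (a s) = g (.inl s)) : LinearIndependent R a :=
  .of_comp i ((funext ha : i ∘ a = g ∘ Sum.inl) ▸ hg.comp _ Sum.inl_injective)

lemma span_eq_top_of_map_eq_inl (hi : Function.Injective i) (hpi : ∀ a, p (i a) = 0)
    (hg : Submodule.span R (Set.range g) = ⊤) (ha : ∀ s, i (a s) = g (.inl s))
    (hr : LinearIndependent R fun t => p (g (.inr t))) :
    Submodule.span R (Set.range a) = ⊤ := by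
  have map_span : (Submodule.span R (Set.range a)).map i =
      Submodule.span R (Set.range (g ∘ Sum.inl)) := by
    rw [Submodule.map_span, ← Set.range_comp]
    exact congrArg (fun f => Submodule.span R (Set.range f)) (funext ha)
  have disjoint : Disjoint (Submodule.span R (Set.range (g ∘ Sum.inr))) (LinearMap.ker p) :=
    Submodule.range_ker_disjoint hr
  refine eq_top_iff.mpr fun m _ => (hi.mem_set_image (s := Submodule.span R (Set.range a))).mp ?_
  change i m ∈ (Submodule.span R (Set.range a)).map i
  rw [map_span]
  have hm : i m ∈ Submodule.span R (Set.range (g ∘ Sum.inl)) ⊔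
      Submodule.span R (Set.range (g ∘ Sum.inr)) := by
    rw [← Submodule.span_union, ← Set.Sum.elim_range, Sum.elim_comp_inl_inr, hg]
    trivial
  obtain ⟨y, hy, z, hz, hyz⟩ := Submodule.mem_sup.mp hm
  have hy' : p y = 0 := by
    obtain ⟨a', -, rfl⟩ := map_span ▸ hy
    exact hpi a'
  have hz' : p z = 0 := by
    rw [← hpi m, ← hyz, map_add, hy', zero_add]
  rw [← hyz, Submodule.disjoint_def.mp disjoint z hz hz', add_zero]
  exact hy

lemma span_map_inr_eq_top (hp : Function.Surjective p) (hg0 : ∀ s, p (g (.inl s)) = 0)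
    (hg : Submodule.span R (Set.range g) = ⊤) :
    Submodule.span R (Set.range fun t => p (g (.inr t))) = ⊤ := by
  rw [eq_top_iff, ← LinearMap.range_eq_top.mpr hp, LinearMap.range_eq_map, ← hg,
    Submodule.map_span, Submodule.span_le]
  rintro _ ⟨_, ⟨s | t, rfl⟩, rfl⟩
  · rw [hg0]
    exact zero_mem _
  · exact Submodule.subset_span ⟨t, rfl⟩

end ExactSequences

namespace CurveBundle

open Limits

variable {k : Type u} [Field k] {C : SmoothProjectiveCurve k} {E F : CurveBundle C}

lemma section_eq_zero_of_sectionGerm_eq_zero (F : CurveBundle C) {U : C.X.Opens} {x : C.X}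
    (hx : x ∈ U) {s : Γ(F.sheaf, U)} (hs : sectionGerm F.sheaf hx s = 0) : s = 0 := by
  refine section_ext F.sheaf fun y hy => F.toGenericStalk_injective y ?_
  rw [map_zero, map_zero, toGenericStalk_sectionGerm, ← toGenericStalk_sectionGerm F.sheaf hx, hs,
    map_zero]

lemma linearIndependent_sectionGerm_iff (F : CurveBundle C) {U : C.X.Opens} {x y : C.X}
    (hx : x ∈ U) (hy : y ∈ U) {ι : Type*} (s : ι → Γ(F.sheaf, U)) :
    LinearIndependent (C.X.presheaf.stalk x) (fun i => sectionGerm F.sheaf hx (s i)) ↔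
      LinearIndependent (C.X.presheaf.stalk y) (fun i => sectionGerm F.sheaf hy (s i)) := by
  rw [← F.linearIndependent_toGenericStalk_iff x, ← F.linearIndependent_toGenericStalk_iff y]
  simp only [Function.comp_def, toGenericStalk_sectionGerm]

/-- The kernel and the range of `f` on the stalk at `x` are free, the stalk of the structure sheaf
being a principal ideal domain. -/
lemma exists_basis_stalk_ker_range (f : E.sheaf ⟶ F.sheaf) (x : C.X) :
    ∃ (a b : ℕ) (B : Module.Basis (Fin a ⊕ Fin b) (C.X.presheaf.stalk x)
        (E.sheaf.presheaf.stalk x)),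
      (∀ i, stalkLinearMap f x (B (.inl i)) = 0) ∧
      LinearIndependent (C.X.presheaf.stalk x) (fun i => stalkLinearMap f x (B (.inr i))) := by
  have := C.isPrincipalIdealRing_stalk x
  have := Module.Free.of_basis (E.stalkBasis x)
  have := Module.Finite.of_basis (E.stalkBasis x)
  have := Module.Free.of_basis (F.stalkBasis x)
  let g := stalkLinearMap f x
  let κ := Module.finBasis (C.X.presheaf.stalk x) (LinearMap.ker g)
  let ρ := Module.finBasis (C.X.presheaf.stalk x) (LinearMap.range g)
  choose l hl using fun i => LinearMap.surjective_rangeRestrict g (ρ i)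
  have hexact : Function.Exact (LinearMap.ker g).subtype g.rangeRestrict :=
    LinearMap.exact_iff.mpr (by rw [LinearMap.ker_rangeRestrict, Submodule.range_subtype])
  refine ⟨_, _, exactBasis (LinearMap.ker g).subtype_injective hexact κ ρ hl, fun i => ?_, ?_⟩
  · rw [exactBasis_inl]
    exact (κ i).2
  · simp only [exactBasis_inr]
    convert! ρ.linearIndependent.map' (LinearMap.range g).subtype (Submodule.ker_subtype _) using 1
    exact funext fun i => congrArg Subtype.val (hl i)

lemma exists_adapted_frame (f : E.sheaf ⟶ F.sheaf) (x : C.X) :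
    ∃ (a b : ℕ) (W : C.X.Opens) (_ : x ∈ W) (t : Fin a ⊕ Fin b → Γ(E.sheaf, W)),
      (∀ y (hy : y ∈ W), LinearIndependent (C.X.presheaf.stalk y)
        (fun i => sectionGerm E.sheaf hy (t i))) ∧
      (∀ y (hy : y ∈ W), Submodule.span (C.X.presheaf.stalk y)
        (Set.range fun i => sectionGerm E.sheaf hy (t i)) = ⊤) ∧
      (∀ i, f.app W (t (.inl i)) = 0) ∧
      ∀ y (hy : y ∈ W), LinearIndependent (C.X.presheaf.stalk y)
        (fun i => sectionGerm F.sheaf hy (f.app W (t (.inr i)))) := by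
  obtain ⟨a, b, B, hB, hB'⟩ := exists_basis_stalk_ker_range f x
  obtain ⟨W, hW, t, ht, hspread⟩ := (E.isFrame_frame x).exists_spread_basis (E.mem_nhd x) B
  refine ⟨a, b, W, hW, t, fun y hy => (hspread y hy).1, fun y hy => (hspread y hy).2,
    fun i => section_eq_zero_of_sectionGerm_eq_zero F hW ?_, fun y hy => ?_⟩
  · rw [← stalkLinearMap_sectionGerm, ht, hB]
  · refine (linearIndependent_sectionGerm_iff F hW hy _).mp ?_
    simpa only [← stalkLinearMap_sectionGerm, ht] using hB'

lemma exists_frame_kernel (f : E.sheaf ⟶ F.sheaf) (x : C.X) :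
    ∃ U : C.X.Opens, x ∈ U ∧ ∃ (n : ℕ) (s : Fin n → Γ(kernel f, U)), IsFrame (kernel f) U s := by
  obtain ⟨a, b, W, hW, t, hli, hspan, hzero, hli'⟩ := exists_adapted_frame f x
  choose s hs using fun i => exists_app_eq_of_exact (ShortComplex.exact_kernel f) W (t (.inl i))
    (hzero i)
  have germ_eq (y) (hy : y ∈ W) (i) : stalkLinearMap (kernel.ι f) y (sectionGerm _ hy (s i)) =
      sectionGerm E.sheaf hy (t (.inl i)) :=
    (stalkLinearMap_sectionGerm _ hy _).trans (congrArg _ (hs i))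
  refine ⟨W, hW, a, s, isFrame_of_sectionGerm (fun y hy => ?_) fun y hy => ?_⟩
  · exact linearIndependent_of_map_eq_inl (hli y hy) (germ_eq y hy)
  · refine span_eq_top_of_map_eq_inl (p := stalkLinearMap f y)
      (stalkLinearMap_injective (kernel.ι f) y)
      (exact_stalkLinearMap (ShortComplex.exact_kernel f) y).apply_apply_eq_zero (hspan y hy)
      (germ_eq y hy) ?_
    simpa only [stalkLinearMap_sectionGerm] using hli' y hy

lemma exists_frame_image (f : E.sheaf ⟶ F.sheaf) (x : C.X) :
    ∃ U : C.X.Opens, x ∈ U ∧ ∃ (n : ℕ) (s : Fin n → Γ(image f, U)), IsFrame (image f) U s := by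
  obtain ⟨a, b, W, hW, t, -, hspan, hzero, hli'⟩ := exists_adapted_frame f x
  have image_app (y) (hy : y ∈ W) (i) : stalkLinearMap (image.ι f) y
      (stalkLinearMap (factorThruImage f) y (sectionGerm E.sheaf hy (t i))) =
        sectionGerm F.sheaf hy (f.app W (t i)) := by
    rw [← LinearMap.comp_apply, ← stalkLinearMap_comp, image.fac, stalkLinearMap_sectionGerm]
  refine ⟨W, hW, b, fun i => (factorThruImage f).app W (t (.inr i)),
    isFrame_of_sectionGerm (fun y hy => ?_) fun y hy => ?_⟩ <;>
    simp only [← stalkLinearMap_sectionGerm]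
  · apply LinearIndependent.of_comp (stalkLinearMap (image.ι f) y)
    simpa only [Function.comp_def, image_app] using hli' y hy
  · refine span_map_inr_eq_top (g := fun i => sectionGerm E.sheaf hy (t i))
      (stalkLinearMap_surjective (factorThruImage f) y) (fun i => ?_) (hspan y hy)
    apply stalkLinearMap_injective (image.ι f) y
    rw [image_app, hzero, map_zero, map_zero]

/-- The kernel of a morphism of vector bundles on a curve, as a vector bundle. -/
noncomputable def kernelBundle (f : E.sheaf ⟶ F.sheaf) : CurveBundle C :=
  ofExistsFrame (kernel f) (exists_frame_kernel f)

/-- The image sheaf of a morphism of vector bundles on a curve, as a vector bundle. It need not be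
saturated in the target. -/
noncomputable def imageBundle (f : E.sheaf ⟶ F.sheaf) : CurveBundle C :=
  ofExistsFrame (image f) (exists_frame_image f)

lemma shortExact_kernel_image (f : E.sheaf ⟶ F.sheaf) :
    ∃ w : kernel.ι f ≫ factorThruImage f = 0,
      (ShortComplex.mk (kernel.ι f) (factorThruImage f) w).ShortExact := by
  have w : kernel.ι f ≫ factorThruImage f = 0 := by
    rw [← cancel_mono (image.ι f), Category.assoc, image.fac, kernel.condition, zero_comp]
  refine ⟨w, .mk' ?_ inferInstance inferInstance⟩
  let φ : ShortComplex.mk (kernel.ι f) (factorThruImage f) w ⟶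
      ShortComplex.mk (kernel.ι f) f (kernel.condition f) :=
    { τ₁ := 𝟙 _, τ₂ := 𝟙 _, τ₃ := image.ι f }
  have : Epi φ.τ₁ := inferInstanceAs (Epi (𝟙 _))
  have : IsIso φ.τ₂ := inferInstanceAs (IsIso (𝟙 _))
  have : Mono φ.τ₃ := inferInstanceAs (Mono (image.ι f))
  exact (ShortComplex.exact_iff_of_epi_of_isIso_of_mono φ).mpr (ShortComplex.exact_kernel f)

end CurveBundle

lemma basis_det_eq_mul_of_exact {R A B D α β : Type*} [CommRing R] [AddCommGroup A]
    [AddCommGroup B] [AddCommGroup D] [Module R A] [Module R B] [Module R D] [Fintype α]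
    [Fintype β] [DecidableEq α] [DecidableEq β] {i : A →ₗ[R] B} {p : B →ₗ[R] D}
    (hpi : ∀ a, p (i a) = 0) {a a' : Module.Basis α R A} {d d' : Module.Basis β R D}
    {b b' : Module.Basis (α ⊕ β) R B} (hinl : ∀ s, b (.inl s) = i (a s))
    (hinl' : ∀ s, b' (.inl s) = i (a' s)) (hinr : ∀ t, p (b (.inr t)) = d t)
    (hinr' : ∀ t, p (b' (.inr t)) = d' t) : b.det b' = a.det a' * d.det d' := by
  have coord_inl (s : α) : b.coord (.inl s) ∘ₗ i = a.coord s :=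
    a.ext fun t => by simp [← hinl, Finsupp.single_apply]
  have coord_inr (t : β) : d.coord t ∘ₗ p = b.coord (.inr t) := by
    refine b.ext (Sum.rec (fun s => ?_) fun s => ?_)
    · have : p (b (.inl s)) = 0 := hinl s ▸ hpi _
      simp [this]
    · simp [hinr, Finsupp.single_apply]
  have toMatrix_eq : b.toMatrix b' = Matrix.fromBlocks (a.toMatrix a')
      (.of fun s t => b.coord (.inl s) (b' (.inr t))) 0 (d.toMatrix d') := by
    ext (s | s) (t | t)
    · simp [Module.Basis.toMatrix_apply, hinl', ← Module.Basis.coord_apply, ← coord_inl]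
    · simp [Module.Basis.toMatrix_apply]
    · simp [Module.Basis.toMatrix_apply, hinl', ← Module.Basis.coord_apply, ← coord_inr, hpi]
    · simp [Module.Basis.toMatrix_apply, ← Module.Basis.coord_apply, ← coord_inr, hinr']
  rw [Module.Basis.det_apply, toMatrix_eq, Matrix.det_fromBlocks_zero₂₁, Module.Basis.det_apply,
    Module.Basis.det_apply]

namespace SmoothProjectiveCurve

variable {k : Type u} [Field k] (C : SmoothProjectiveCurve k)

lemma ord_algebraMap_of_isUnit (x : C.X) {a : C.X.presheaf.stalk x} (ha : IsUnit a) :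
    C.X.ord (algebraMap _ C.X.functionField a) x = 0 := by
  by_cases hx : x = genericPoint C.X
  · subst hx
    exact C.ord_genericPoint _
  have val_eq_one : C.val ⟨x, hx⟩ (algebraMap _ C.X.functionField a) = 1 :=
    (C.val_algebraMap_le_one ⟨x, hx⟩ a).antisymm <| not_lt.mp fun h =>
      (IsLocalRing.mem_maximalIdeal _).mp ((C.val_algebraMap_lt_one_iff ⟨x, hx⟩ a).mp h) ha
  rw [C.ord_eq_neg_log_val ⟨x, hx⟩, val_eq_one, WithZero.log_one, neg_zero]

lemma finite_support_ord {f : C.X.functionField} (hf : f ≠ 0) :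
    (Function.support fun x : C.X => C.X.ord f x * (C.pointDegree x : ℤ)).Finite := by
  refine ((C.finite_val_ne_one hf).image Subtype.val).subset fun x hx => ?_
  have ord_ne_zero : C.X.ord f x ≠ 0 := left_ne_zero_of_mul hx
  have hxη : x ≠ genericPoint C.X := by
    rintro rfl
    exact ord_ne_zero (C.ord_genericPoint f)
  refine ⟨⟨x, hxη⟩, fun h => ord_ne_zero ?_, rfl⟩
  rw [C.ord_eq_neg_log_val ⟨x, hxη⟩, h, WithZero.log_one, neg_zero]

end SmoothProjectiveCurve

namespace CurveBundle

variable {k : Type u} [Field k] {C : SmoothProjectiveCurve k}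

lemma detTransition_eq_det (E : CurveBundle C) (x : C.X) :
    E.detTransition x = (E.genericBasis x).det (E.genericBasis (genericPoint C.X)) := by
  have hη : genericPoint C.X ∈ E.nhd (genericPoint C.X) ⊓ E.nhd x :=
    ⟨E.mem_nhd _, genericPoint_mem (E.mem_nhd x)⟩
  refine ((E.isFrame_frame x).germ_basis_det inf_le_right hη _).trans
    (congrArg (E.genericBasis x).det (funext fun i => ?_))
  rw [sectionGerm_resSection, genericBasis, IsFrame.stalkBasis_apply]

lemma detTransition_ne_zero (E : CurveBundle C) (x : C.X) : E.detTransition x ≠ 0 := by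
  rw [detTransition_eq_det]
  exact ((E.genericBasis x).isUnit_det _).ne_zero

lemma ord_det_eq_zero (E : CurveBundle C) (x : C.X)
    (b : Module.Basis (Fin E.rank) (C.X.presheaf.stalk x) (E.sheaf.presheaf.stalk x)) :
    C.X.ord ((E.genericBasis x).det (toGenericStalk E.sheaf x ∘ b)) x = 0 := by
  have := map_basis_det_of_semilinear (algebraMap (C.X.presheaf.stalk x) C.X.functionField) _
    (toGenericStalk_smul _ _) (E.stalkBasis x) (E.genericBasis x)
    (E.genericBasis_apply x) b
  exact this ▸ C.ord_algebraMap_of_isUnit x ((E.stalkBasis x).isUnit_det b)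

lemma finite_support_degree (E : CurveBundle C) :
    (Function.support fun x : C.X =>
      C.X.ord (E.detTransition x) x * (C.pointDegree x : ℤ)).Finite := by
  refine (C.finite_compl _ (E.mem_nhd (genericPoint C.X))).subset fun x hx hmem => hx ?_
  have frame_eq : toGenericStalk E.sheaf x ∘
      (E.isFrame_frame (genericPoint C.X)).stalkBasis hmem = E.genericBasis (genericPoint C.X) := by
    ext i
    rw [Function.comp_apply, genericBasis, IsFrame.stalkBasis_apply, IsFrame.stalkBasis_apply,
      toGenericStalk_sectionGerm]
  have ord_eq_zero := E.ord_det_eq_zero x ((E.isFrame_frame (genericPoint C.X)).stalkBasis hmem)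
  rw [frame_eq, ← detTransition_eq_det] at ord_eq_zero
  simp only [ord_eq_zero, zero_mul]

lemma degree_eq_zero (E : CurveBundle C) (h : E.rank = 0) : E.degree = 0 := by
  have : IsEmpty (Fin E.rank) := by rw [h]; infer_instance
  refine finsum_eq_zero_of_forall_eq_zero fun x => ?_
  have detTransition_eq_one :
      E.detTransition x = algebraMap (C.X.presheaf.stalk x) C.X.functionField 1 := by
    rw [detTransition_eq_det, Module.Basis.det_apply, Matrix.det_isEmpty, map_one]
  rw [detTransition_eq_one, C.ord_algebraMap_of_isUnit x isUnit_one, zero_mul]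

section ShortExact

variable {A E D : CurveBundle C} {i : A.sheaf ⟶ E.sheaf} {p : E.sheaf ⟶ D.sheaf} {w : i ≫ p = 0}

lemma rank_eq_add (hS : (ShortComplex.mk i p w).ShortExact) : E.rank = A.rank + D.rank := by
  have := hS.mono_f
  have := hS.epi_g
  let η := genericPoint C.X
  let i' : A.sheaf.presheaf.stalk η →ₗ[C.X.functionField] E.sheaf.presheaf.stalk η :=
    stalkLinearMap i η
  let p' : E.sheaf.presheaf.stalk η →ₗ[C.X.functionField] D.sheaf.presheaf.stalk η :=
    stalkLinearMap p η
  have hker : LinearMap.ker p' = LinearMap.range i' :=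
    LinearMap.exact_iff.mp (exact_stalkLinearMap hS.exact η)
  have hrange : LinearMap.range p' = ⊤ :=
    LinearMap.range_eq_top.mpr (stalkLinearMap_surjective p η)
  have := LinearMap.finrank_range_add_finrank_ker p'
  rw [hker, LinearMap.finrank_range_of_inj (f := i') (stalkLinearMap_injective i η), hrange,
    finrank_top, finrank_genericStalk, finrank_genericStalk, finrank_genericStalk] at this
  omega

lemma exists_adapted_basis (hS : (ShortComplex.mk i p w).ShortExact) (x : C.X) :
    ∃ (B : Module.Basis (Fin A.rank ⊕ Fin D.rank) (C.X.presheaf.stalk x)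
        (E.sheaf.presheaf.stalk x))
      (β : Module.Basis (Fin A.rank ⊕ Fin D.rank) C.X.functionField
        (E.sheaf.presheaf.stalk (genericPoint C.X))),
      (∀ s, β s = toGenericStalk E.sheaf x (B s)) ∧
      (∀ s, β (.inl s) = stalkLinearMap i (genericPoint C.X) (A.genericBasis x s)) ∧
      ∀ t, stalkLinearMap p (genericPoint C.X) (β (.inr t)) = D.genericBasis x t := by
  have := hS.mono_f
  have := hS.epi_g
  choose l hl using fun t => stalkLinearMap_surjective p x (D.stalkBasis x t)
  have hl' (t) : stalkLinearMap p (genericPoint C.X) (toGenericStalk E.sheaf x (l t)) =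
      D.genericBasis x t := by
    rw [stalkLinearMap_toGenericStalk, hl, genericBasis_apply]
  let B := exactBasis (stalkLinearMap_injective i x) (exact_stalkLinearMap hS.exact x)
    (A.stalkBasis x) (D.stalkBasis x) hl
  let β := exactBasis (R := C.X.functionField) (stalkLinearMap_injective i (genericPoint C.X))
    (exact_stalkLinearMap hS.exact _) (A.genericBasis x) (D.genericBasis x) hl'
  refine ⟨B, β, ?_, exactBasis_inl _ _ _ _ _, fun t => ?_⟩
  · rintro (s | t)
    · rw [exactBasis_inl, exactBasis_inl, genericBasis_apply, stalkLinearMap_toGenericStalk]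
    · rw [exactBasis_inr, exactBasis_inr]
  · rw [exactBasis_inr, hl']

/-- With bases adapted to the sequence at `x` and at the generic point, the transition matrix of `E`
is block triangular up to a matrix invertible at `x` and a constant one. -/
lemma exists_ord_detTransition_eq (hS : (ShortComplex.mk i p w).ShortExact) :
    ∃ c : C.X.functionField, c ≠ 0 ∧ ∀ x, C.X.ord (E.detTransition x) x =
      C.X.ord (A.detTransition x) x + C.X.ord (D.detTransition x) x + C.X.ord c x := by
  have := hS.mono_f
  choose B β hβ hβl hβr using exists_adapted_basis hS
  let η := genericPoint C.X
  let e : Fin A.rank ⊕ Fin D.rank ≃ Fin E.rank :=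
    finSumFinEquiv.trans (finCongr (rank_eq_add hS).symm)
  let c : C.X.functionField := ((β η).reindex e).det (E.genericBasis η)
  have hc : c ≠ 0 := (((β η).reindex e).isUnit_det _).ne_zero
  refine ⟨c, hc, fun x => ?_⟩
  let a : C.X.functionField := (E.genericBasis x).det ((β x).reindex e)
  have ha : a ≠ 0 := ((E.genericBasis x).isUnit_det _).ne_zero
  have ord_a : C.X.ord a x = 0 := by
    convert! E.ord_det_eq_zero x ((B x).reindex e) using 3
    ext s
    simp [hβ]
  have block : ((β x).reindex e).det ((β η).reindex e) =
      A.detTransition x * D.detTransition x := by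
    rw [detTransition_eq_det, detTransition_eq_det, ← basis_det_eq_mul_of_exact
      (exact_stalkLinearMap hS.exact η).apply_apply_eq_zero (hβl x) (hβl η) (hβr x) (hβr η),
      Module.Basis.det_reindex]
    congr 1
    ext s
    simp
  have factor : E.detTransition x = a * (A.detTransition x * D.detTransition x) * c := by
    rw [← block, detTransition_eq_det, Module.Basis.det_mul_det, Module.Basis.det_mul_det]
  have hA := A.detTransition_ne_zero x
  have hD := D.detTransition_ne_zero x
  rw [factor, Scheme.ord_mul (mul_ne_zero ha (mul_ne_zero hA hD)) hc,
    Scheme.ord_mul ha (mul_ne_zero hA hD), Scheme.ord_mul hA hD, ord_a, zero_add]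

theorem degree_eq_add (hS : (ShortComplex.mk i p w).ShortExact) :
    E.degree = A.degree + D.degree := by
  obtain ⟨c, hc, hord⟩ := exists_ord_detTransition_eq hS
  have hA := A.finite_support_degree
  have hD := D.finite_support_degree
  simp only [degree, hord, add_mul]
  rw [finsum_add_distrib ((hA.union hD).subset (Function.support_add _ _))
    (C.finite_support_ord hc), finsum_add_distrib hA hD, C.finsum_ord_mul_pointDegree hc, add_zero]

end ShortExact

open Limits

variable {E F : CurveBundle C}

/-- The map on generic stalks, linear over the function field. -/
noncomputable def genericMap (f : E.sheaf ⟶ F.sheaf) :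
    E.sheaf.presheaf.stalk (genericPoint C.X) →ₗ[C.X.functionField]
      F.sheaf.presheaf.stalk (genericPoint C.X) :=
  stalkLinearMap f (genericPoint C.X)

lemma mono_iff_genericMap_injective (f : E.sheaf ⟶ F.sheaf) :
    Mono f ↔ Function.Injective (genericMap f) := by
  refine ⟨fun _ => stalkLinearMap_injective f _, fun hf =>
    mono_of_stalkLinearMap_injective f fun x => ?_⟩
  have hcomp : toGenericStalk F.sheaf x ∘ stalkLinearMap f x =
      genericMap f ∘ toGenericStalk E.sheaf x :=
    funext fun m => (stalkLinearMap_toGenericStalk f x m).symm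
  exact (hcomp ▸ hf.comp (E.toGenericStalk_injective x)).of_comp

lemma rank_le_of_mono (f : E.sheaf ⟶ F.sheaf) [hf : Mono f] : E.rank ≤ F.rank := by
  rw [← E.finrank_genericStalk, ← F.finrank_genericStalk]
  exact LinearMap.finrank_le_finrank_of_injective ((mono_iff_genericMap_injective f).mp hf)

lemma mono_iff_genericallySurjective (f : E.sheaf ⟶ F.sheaf) (h : E.rank = F.rank) :
    Mono f ↔ GenericallySurjective f := by
  rw [mono_iff_genericMap_injective]
  refine LinearMap.injective_iff_surjective_of_finrank_eq_finrank (f := genericMap f) ?_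
  rw [E.finrank_genericStalk, F.finrank_genericStalk, h]

lemma rank_eq_rank_kernelBundle_add (f : E.sheaf ⟶ F.sheaf) :
    E.rank = (kernelBundle f).rank + (imageBundle f).rank :=
  rank_eq_add (shortExact_kernel_image f).choose_spec

lemma degree_eq_degree_kernelBundle_add (f : E.sheaf ⟶ F.sheaf) :
    E.degree = (kernelBundle f).degree + (imageBundle f).degree :=
  degree_eq_add (shortExact_kernel_image f).choose_spec

lemma mono_of_rank_kernelBundle_eq_zero {f : E.sheaf ⟶ F.sheaf} (h : (kernelBundle f).rank = 0) :
    Mono f := by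
  rw [mono_iff_genericMap_injective, injective_iff_map_eq_zero]
  intro m hm
  obtain ⟨t, rfl⟩ := (exact_stalkLinearMap (ShortComplex.exact_kernel f) _ m).mp hm
  rw [← finrank_genericStalk, Module.finrank_eq_zero_iff_of_free] at h
  exact (congrArg _ (h.elim t 0)).trans (map_zero _)

/-- A subsheaf of a vector bundle which is itself a vector bundle; the quotient may have torsion. -/
structure Subsheaf (E : CurveBundle C) where
  /-- the vector bundle -/
  bundle : CurveBundle C
  /-- the inclusion -/
  ι : bundle.sheaf ⟶ E.sheaf
  mono : Mono ι

namespace Subsheaf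

/-- The kernel of a morphism of vector bundles as a subsheaf of the source. -/
noncomputable def kernel (f : E.sheaf ⟶ F.sheaf) : Subsheaf E :=
  ⟨kernelBundle f, Limits.kernel.ι f, inferInstanceAs (Mono (Limits.kernel.ι f))⟩

/-- The image of a morphism of vector bundles as a subsheaf of the target. -/
noncomputable def image (f : E.sheaf ⟶ F.sheaf) : Subsheaf F :=
  ⟨imageBundle f, Limits.image.ι f, inferInstanceAs (Mono (Limits.image.ι f))⟩

/-- The zero subsheaf, realised as the kernel of the identity. -/
noncomputable def zero (E : CurveBundle C) : Subsheaf E := kernel (𝟙 E.sheaf)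

/-- A vector bundle as a subsheaf of itself. -/
def full (E : CurveBundle C) : Subsheaf E := ⟨E, 𝟙 _, inferInstance⟩

lemma ι_zero (E : CurveBundle C) : (zero E).ι = 0 :=
  (Category.comp_id _).symm.trans (kernel.condition (𝟙 E.sheaf))

lemma rank_zero (E : CurveBundle C) : (zero E).bundle.rank = 0 := by
  have hzero : genericMap (zero E).ι = 0 := by
    rw [ι_zero]
    exact stalkLinearMap_zero _
  have hinj := (mono_iff_genericMap_injective _).mp (zero E).mono
  rw [← finrank_genericStalk, Module.finrank_eq_zero_iff_of_free]
  exact ⟨fun a b => hinj (by rw [hzero]; rfl)⟩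

end Subsheaf

/-- The weight `deg E + a rk E` of a bundle placed at a vertex with parameter `a`. -/
noncomputable def weight (a : ℝ) (E : CurveBundle C) : ℝ := E.degree + E.rank * a

lemma weight_eq_zero (a : ℝ) (h : E.rank = 0) : weight a E = 0 := by
  rw [weight, h, E.degree_eq_zero h, Int.cast_zero, Nat.cast_zero, zero_mul, add_zero]

end CurveBundle

namespace BundleChain

open CurveBundle

variable {k : Type u} [Field k] {C : SmoothProjectiveCurve k} {r : ℕ} {α : Fin (r + 1) → ℝ}
  {E : BundleChain C r}

lemma sum_weight_sub_slope (α : Fin (r + 1) → ℝ) (E : BundleChain C r) (μ : ℝ) :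
    ∑ i, weight (α i - μ) (E.E i) = (slope α E - μ) * E.totalRank := by
  rw [slope, sub_mul, Finset.sum_mul, totalRank, Nat.cast_sum, Finset.mul_sum,
    ← Finset.sum_sub_distrib]
  refine Finset.sum_congr rfl fun i _ => ?_
  obtain hi | hi := eq_or_ne (E.E i).rank 0
  · simp [weight_eq_zero _ hi, hi]
  have hrank : ((E.E i).rank : ℝ) ≠ 0 := Nat.cast_ne_zero.mpr hi
  have htotal : (∑ i, ((E.E i).rank : ℝ)) ≠ 0 :=
    (Finset.sum_pos' (fun j _ => Nat.cast_nonneg (E.E j).rank)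
      ⟨i, Finset.mem_univ i, (Nat.cast_nonneg _).lt_of_ne' hrank⟩).ne'
  rw [weight]
  field_simp
  ring

namespace IsSemistable

/-- Shifting `α` by the slope normalises the slope of `E` to zero, so semistability says that
subchains have nonpositive weight. -/
lemma sum_weight_nonpos (hE : E.IsSemistable α) (T : ∀ i, Subsheaf (E.E i))
    (hT : ∀ i : Fin r, ∃ ψ : (T i.succ).bundle.sheaf ⟶ (T i.castSucc).bundle.sheaf,
      ψ ≫ (T i.castSucc).ι = (T i.succ).ι ≫ E.φ i) :
    ∑ i, weight (α i - slope α E) (T i).bundle ≤ 0 := by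
  choose ψ hψ using hT
  let E' : BundleChain C r := ⟨fun i => (T i).bundle, ψ⟩
  refine (sum_weight_sub_slope α E' (slope α E)).trans_le ?_
  obtain h | h := eq_or_ne E'.totalRank 0
  · rw [h, Nat.cast_zero, mul_zero]
  · exact mul_nonpos_of_nonpos_of_nonneg
      (sub_nonpos.mpr (hE E' ⟨fun i => (T i).ι, hψ⟩ (fun i => (T i).mono) h)) (Nat.cast_nonneg _)

lemma weight_kernelBundle_nonpos (hE : E.IsSemistable α) (i : Fin r) :
    weight (α i.succ - slope α E) (kernelBundle (E.φ i)) ≤ 0 := by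
  let T : ∀ j, Subsheaf (E.E j) :=
    Function.update (fun j => .zero (E.E j)) i.succ (.kernel (E.φ i))
  have hi : T i.succ = .kernel (E.φ i) := Function.update_self _ _ _
  have hne (j) (hj : j ≠ i.succ) : T j = .zero (E.E j) := Function.update_of_ne hj _ _
  have ι_comp_φ (l : Fin r) : (T l.succ).ι ≫ E.φ l = 0 := by
    obtain rfl | hl := eq_or_ne l i
    · rw [hi]
      exact Limits.kernel.condition _
    · rw [hne _ ((Fin.succ_injective _).ne hl), Subsheaf.ι_zero, Limits.zero_comp]
  have hsum := hE.sum_weight_nonpos T fun l => ⟨0, by rw [ι_comp_φ, Limits.zero_comp]⟩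
  rwa [Finset.sum_eq_single_of_mem i.succ (Finset.mem_univ _) fun j _ hj =>
    weight_eq_zero _ (by rw [hne j hj, Subsheaf.rank_zero]), hi] at hsum

lemma weight_imageBundle_le (hE : E.IsSemistable α) (i : Fin r) :
    weight (α i.castSucc - slope α E) (imageBundle (E.φ i)) ≤
      weight (α i.castSucc - slope α E) (E.E i.castSucc) := by
  let T : ∀ j, Subsheaf (E.E j) :=
    Function.update (fun j => .full (E.E j)) i.castSucc (.image (E.φ i))
  have hi : T i.castSucc = .image (E.φ i) := Function.update_self _ _ _
  have hne (j) (hj : j ≠ i.castSucc) : T j = .full (E.E j) := Function.update_of_ne hj _ _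
  have hsum := hE.sum_weight_nonpos T fun l => by
    obtain rfl | hl := eq_or_ne l i
    · rw [hi]
      exact ⟨(T l.succ).ι ≫ Limits.factorThruImage (E.φ l), (Category.assoc _ _ _).trans
        (congrArg _ (Limits.image.fac _))⟩
    · rw [hne _ ((Fin.castSucc_injective _).ne hl)]
      exact ⟨(T l.succ).ι ≫ E.φ l, Category.comp_id _⟩
  have hsum_full : ∑ j, weight (α j - slope α E) (E.E j) = 0 := by
    rw [sum_weight_sub_slope, sub_self, zero_mul]
  rw [← hsum_full, ← Finset.add_sum_erase _ _ (Finset.mem_univ i.castSucc),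
    ← Finset.add_sum_erase _ (fun j => weight _ (E.E j)) (Finset.mem_univ i.castSucc),
    Finset.sum_congr rfl fun j hj => by rw [hne j (Finset.ne_of_mem_erase hj)], hi] at hsum
  exact le_of_add_le_add_right hsum

lemma rank_kernelBundle_mul_le (hE : E.IsSemistable α) (i : Fin r) :
    (kernelBundle (E.φ i)).rank * (α i.succ - α i.castSucc) ≤
      ((E.E i.castSucc).degree - (E.E i.succ).degree : ℝ) +
        ((E.E i.succ).rank - (E.E i.castSucc).rank) * (slope α E - α i.castSucc) := by
  have hker := hE.weight_kernelBundle_nonpos i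
  have him := hE.weight_imageBundle_le i
  rw [weight] at hker
  rw [weight, weight] at him
  rw [rank_eq_rank_kernelBundle_add (E.φ i), degree_eq_degree_kernelBundle_add (E.φ i)]
  push_cast
  linarith

end IsSemistable

end BundleChain

section Telescoping

variable {h : ℕ}

lemma last_eq_add_sum_of_succ_eq_add {G : Type*} [AddCommMonoid G] (A : Fin (h + 1) → G)
    (g : Fin h → G) (hA : ∀ l, A l.succ = A l.castSucc + g l) :
    A (Fin.last h) = A 0 + ∑ l, g l := by
  induction h with
  | zero => rw [Fin.sum_univ_zero, add_zero]; rfl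
  | succ h ih =>
    rw [Fin.sum_univ_castSucc, ← add_assoc, ← Fin.succ_last, hA]
    exact congrArg (· + _)
      (ih (fun l => A l.castSucc) (fun l => g l.castSucc) fun l => hA l.castSucc)

lemma sum_succ_sub_mul_le {R : Type*} [CommRing R] [LinearOrder R] [IsStrictOrderedRing R]
    (A : Fin (h + 1) → R) (h0 : A 0 = 0) (hA : ∀ l, A l ≤ 0) (μ : Fin h → R) (hμ : Antitone μ)
    (c : R) (hc : ∀ l, c ≤ μ l) :
    ∑ l, (A l.succ - A l.castSucc) * μ l ≤ A (Fin.last h) * c := by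
  induction h generalizing c with
  | zero => simp [h0]
  | succ h ih =>
    have hinit := ih (fun l => A l.castSucc) h0 (fun l => hA _) (fun l => μ l.castSucc)
      (fun a b hab => hμ (Fin.castSucc_le_castSucc_iff.mpr hab)) (μ (Fin.last h))
      fun l => hμ (Fin.le_last _)
    rw [Fin.sum_univ_castSucc, Fin.succ_last]
    calc _ ≤ A (Fin.last h).castSucc * μ (Fin.last h) +
          (A (Fin.last (h + 1)) - A (Fin.last h).castSucc) * μ (Fin.last h) := by
          gcongr
          exact hinit
      _ = A (Fin.last (h + 1)) * μ (Fin.last h) := by ring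
      _ ≤ A (Fin.last (h + 1)) * c := mul_le_mul_of_nonpos_left (hc _) (hA _)

end Telescoping

namespace BundleChain.HNFlag

open CurveBundle

variable {k : Type u} [Field k] {C : SmoothProjectiveCurve k} {r : ℕ} {α : Fin (r + 1) → ℝ}
  {E : BundleChain C r} (flag : E.HNFlag α)

lemma mono_φ {i : Fin r} (hE : Mono (E.φ i)) (l : Fin (flag.h + 1)) :
    Mono ((flag.F l).φ i) := by
  induction l using Fin.reverseInduction with
  | last => rwa [flag.top_eq]
  | cast l ih =>
    obtain ⟨_, hS⟩ := flag.shortExact l i.succ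
    have : Mono ((flag.incl l).app i.succ) := hS.mono_f
    have := mono_comp ((flag.incl l).app i.succ) ((flag.F l.succ).φ i)
    rw [← (flag.incl l).comm] at this
    exact mono_of_mono _ ((flag.incl l).app i.castSucc)

lemma rank_F_zero (i : Fin (r + 1)) : ((flag.F 0).E i).rank = 0 :=
  Finset.sum_eq_zero_iff.mp flag.bot_eq i (Finset.mem_univ i)

lemma rank_F_succ (l : Fin flag.h) (i : Fin (r + 1)) :
    ((flag.F l.succ).E i).rank = ((flag.F l.castSucc).E i).rank + ((flag.G l).E i).rank :=
  rank_eq_add (flag.shortExact l i).choose_spec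

lemma sum_rank (i : Fin (r + 1)) : ∑ l, ((flag.G l).E i).rank = (E.E i).rank := by
  have h := last_eq_add_sum_of_succ_eq_add (fun l => ((flag.F l).E i).rank) _
    (flag.rank_F_succ · i)
  rw [flag.top_eq, flag.rank_F_zero, zero_add] at h
  exact h.symm

lemma sum_degree (i : Fin (r + 1)) : ∑ l, ((flag.G l).E i).degree = (E.E i).degree := by
  have h := last_eq_add_sum_of_succ_eq_add (fun l => ((flag.F l).E i).degree)
    (fun l => ((flag.G l).E i).degree) fun l => degree_eq_add (flag.shortExact l i).choose_spec
  rw [flag.top_eq, degree_eq_zero _ (flag.rank_F_zero i), zero_add] at h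
  exact h.symm

lemma sum_rank_sub_mul_slope_nonpos {i : Fin r} (hE : Mono (E.φ i))
    (hr : (E.E i.succ).rank = (E.E i.castSucc).rank) :
    ∑ l, (((flag.G l).E i.succ).rank - ((flag.G l).E i.castSucc).rank : ℝ) *
      slope α (flag.G l) ≤ 0 := by
  let A (l : Fin (flag.h + 1)) : ℝ := ((flag.F l).E i.succ).rank - ((flag.F l).E i.castSucc).rank
  have A_zero : A 0 = 0 := by simp only [A, rank_F_zero, sub_self]
  have A_last : A (Fin.last flag.h) = 0 := by simp only [A, flag.top_eq, hr, sub_self]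
  have A_nonpos (l) : A l ≤ 0 := by
    have := flag.mono_φ hE l
    exact sub_nonpos.mpr (Nat.cast_le.mpr (rank_le_of_mono ((flag.F l).φ i)))
  obtain ⟨c, hc⟩ := (Set.finite_range fun l => slope α (flag.G l)).bddBelow
  have habel := sum_succ_sub_mul_le A A_zero A_nonpos _ flag.slope_strictAnti.antitone c
    fun l => hc ⟨l, rfl⟩
  rw [A_last, zero_mul] at habel
  convert! habel using 3 with l
  simp only [A, rank_F_succ, Nat.cast_add]
  ring

lemma sum_rank_kernelBundle_mul_le {i : Fin r} (hE : Mono (E.φ i))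
    (hr : (E.E i.succ).rank = (E.E i.castSucc).rank) :
    (∑ l, (kernelBundle ((flag.G l).φ i)).rank : ℕ) * (α i.succ - α i.castSucc) ≤
      ((E.E i.castSucc).degree - (E.E i.succ).degree : ℝ) := by
  have hsum := Finset.sum_le_sum fun l (_ : l ∈ Finset.univ) =>
    (flag.semistable l).rank_kernelBundle_mul_le i
  have hslope := flag.sum_rank_sub_mul_slope_nonpos hE hr
  simp only [mul_sub _ (slope _ _), ← Finset.sum_mul, Finset.sum_add_distrib,
    Finset.sum_sub_distrib, ← Int.cast_sum, ← Nat.cast_sum, sum_degree, sum_rank] at hsum hslope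
  rw [hr] at hsum
  linarith

lemma rank_G_succ_eq {i : Fin r} (hG : ∀ l, Mono ((flag.G l).φ i))
    (hr : (E.E i.succ).rank = (E.E i.castSucc).rank) (l : Fin flag.h) :
    ((flag.G l).E i.succ).rank = ((flag.G l).E i.castSucc).rank := by
  have hle (l) (_ : l ∈ Finset.univ) :
      ((flag.G l).E i.succ).rank ≤ ((flag.G l).E i.castSucc).rank :=
    have := hG l
    rank_le_of_mono ((flag.G l).φ i)
  refine (Finset.sum_eq_sum_iff_of_le hle).mp ?_ l (Finset.mem_univ l)
  rw [sum_rank, sum_rank, hr]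

end BundleChain.HNFlag

lemma eq_zero_of_natCast_mul_le {R : Type*} [CommRing R] [LinearOrder R] [IsStrictOrderedRing R]
    {m : ℕ} {a d : R} (hd : 0 ≤ d) (hda : d < a) (hm : m * a ≤ d) : m = 0 := by
  have : (m : R) < 1 := lt_of_mul_lt_mul_right (by linarith) (hd.trans hda.le)
  exact Nat.lt_one_iff.mp (by exact_mod_cast this)

theorem proposition6p5 {k : Type u} [Field k] (C : SmoothProjectiveCurve k) (n r : ℕ)
    (d : Fin (r + 1) → ℤ) (α : Fin (r + 1) → ℝ)
    (hd : ∀ i : Fin r, d i.succ ≤ d i.castSucc)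
    (hα : ∀ i : Fin r, (d i.castSucc : ℝ) - (d i.succ : ℝ) < α i.succ - α i.castSucc)
    (E : BundleChain C r) (hrank : ∀ i, (E.E i).rank = n) (hdeg : ∀ i, (E.E i).degree = d i) :
    (E.IsSemistable α → ∀ i : Fin r, Mono (E.φ i) ∧ GenericallySurjective (E.φ i)) ∧
    ((∀ i : Fin r, GenericallySurjective (E.φ i)) →
      ∀ (flag : E.HNFlag α) (j : Fin flag.h), ∃ m : ℕ, ∀ i, ((flag.G j).E i).rank = m) := by
  have hr (i : Fin r) : (E.E i.succ).rank = (E.E i.castSucc).rank := by rw [hrank, hrank]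
  have eq_zero {m : ℕ} (i : Fin r) (hm : m * (α i.succ - α i.castSucc) ≤
      ((E.E i.castSucc).degree - (E.E i.succ).degree : ℝ)) : m = 0 := by
    rw [hdeg, hdeg] at hm
    exact eq_zero_of_natCast_mul_le (sub_nonneg.mpr (Int.cast_le.mpr (hd i))) (hα i) hm
  constructor
  · intro hE i
    have hker := hE.rank_kernelBundle_mul_le i
    rw [hr, sub_self, zero_mul, add_zero] at hker
    have hmono := CurveBundle.mono_of_rank_kernelBundle_eq_zero (eq_zero i hker)
    exact ⟨hmono, (CurveBundle.mono_iff_genericallySurjective _ (hr i)).mp hmono⟩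
  · intro hsurj flag j
    have hmono (i) := (CurveBundle.mono_iff_genericallySurjective _ (hr i)).mpr (hsurj i)
    have hG (i : Fin r) (l) : Mono ((flag.G l).φ i) :=
      CurveBundle.mono_of_rank_kernelBundle_eq_zero <| Finset.sum_eq_zero_iff.mp
        (eq_zero i (flag.sum_rank_kernelBundle_mul_le (hmono i) (hr i))) l (Finset.mem_univ l)
    refine ⟨((flag.G j).E 0).rank, Fin.induction rfl fun i ih => ?_⟩
    rw [flag.rank_G_succ_eq (hG i) (hr i), ih]
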